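/- **Theorem (distribution of $\sigma_k$, given the lens counts).** Let $k\ge 3$, $\lambda\ge 0$ and $\frac1k<r_0<\frac1{k-1}$. Let $\mathcal P_\lambda$ be a homogeneous Poisson point process of intensity $\lambda$ on $[0,1]$, and let $G$ be the graph with vertex set $\mathcal P_\lambda\cup\{0,1\}$ in which two distinct vertices $x,y$ are joined when $|x-y|<r_0$. Let $\sigma_k$ be the number of paths of $G$ with exactly $k$ edges between the vertices $0$ and $1$. For $1\le j\le k-1$ let $L_j=\{x: |x|<jr_0,\ |x-1|<(k-j)r_0\}$ (the $j$-th lens, an interval of length $kr_0-1$). *Notation.* For a finite set $I$ of indices and integers $m_i\ge 0$ let $\mathcal P_I$ be the set of lattice paths from $0$ to $(m_i)_{i\in I}$ with unit steps $e_i$, $i\in I$. For a path $\Pi$ and directions $i\ne j$ let $\pi_{i,j}=\pi_{i,j}(\Pi)$ be the sequence of length $m_j$ whose $t$-th term $\pi_{i,j}(t)$ is the number of steps $e_i$ before the $t$-th step $e_j$, and let $\pi^\star_{i,j}(t)=\#\{s:\pi_{i,j}(s)=t\}$. For $\Pi\in\mathcal P_{\{1,\dots,d\}}$ and $0\le t\le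 m_d$ put $S_t(\Pi)=t$ if $d=1$, and if $d\ge 2$ $$S_t(\Pi)=\sum_{i_{d-1}=1}^{t}\ \sum_{i_{d-2}=1}^{\pi_{d-1,d}(i_{d-1})}\cdots\sum_{i_1=1}^{\pi_{2,3}(i_2)}\pi_{1,2}(i_1)$$ (for $d=2$ this is $\sum_{i_1=1}^t\pi_{1,2}(i_1)$). *Claim.* For all integers $m_1,\dots,m_{k-1}\ge 0$, $$\mathbb P\big(\#(\mathcal P_\lambda\cap L_j)=m_j,\ 1\le j\le k-1\big)=\prod_{j=1}^{k-1}e^{-\lambda(kr_0-1)}\frac{(\lambda(kr_0-1))^{m_j}}{m_j!},$$ and, whenever this probability is not zero, for every integer $n\ge 0$ $$\mathbb P\big(\sigma_k=n \,\big|\, \#(\mathcal P_\lambda\cap L_j)=m_j,\ 1\le j\le k-1\big)=\frac{1}{\binom{m_1+\cdots+m_{k-1}}{m_1,\dots,m_{k-1}}}\ \sum_{\Pi'\in\mathcal P_{\{1,\dots,k-2\}}}\ \sum_{\Pi}\ \prod_{t=0}^{m_{k-2}}\binom{\pi^\star(t)+\sum_{l=1}^{k-3}\pi^\star_{k-2,l}(t)}{\pi^\star(t)},$$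 where the inner sum is over the $\Pi\in\mathcal P_{\{k-2,k-1\}}$ with $\sum_{t=0}^{m_{k-2}}S_t(\Pi')\,\pi^\star(t)=n$, and where $\pi^\star=\pi^\star_{k-2,k-1}(\Pi)$ and $\pi^\star_{k-2,l}=\pi^\star_{k-2,l}(\Pi')$. -/

import Mathlib

/-! ### The Poisson process on the unit interval -/

/-- `N(B)`: the number of points of the configuration `P` in the set `B`. -/
noncomputable def pointCount (P : Finset ℝ) (B : Set ℝ) : ℕ := ((P : Set ℝ) ∩ B).ncard

/-- The random finite set `X` is a homogeneous Poisson point process on `[0,1]` with intensity `lam`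
times Lebesgue measure: the number of points in a Borel set `B` has the Poisson distribution of mean
`lam * |B|`, and the numbers of points in disjoint Borel sets are independent. -/
structure IsPoissonProcess {Ω : Type*} [MeasurableSpace Ω] (μ : MeasureTheory.Measure Ω)
    (lam : NNReal) (X : Ω → Finset ℝ) : Prop where
  subset_unit : ∀ ω, (X ω : Set ℝ) ⊆ Set.Icc 0 1
  measurable_count : ∀ B : Set ℝ, MeasurableSet B → B ⊆ Set.Icc 0 1 →
    Measurable fun ω => pointCount (X ω) B
  map_count : ∀ B : Set ℝ, MeasurableSet B → B ⊆ Set.Icc 0 1 →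
    μ.map (fun ω => pointCount (X ω) B) =
      ProbabilityTheory.poissonMeasure (lam * (MeasureTheory.volume B).toNNReal)
  indep_count : ∀ (N : ℕ) (B : Fin N → Set ℝ), (∀ i, MeasurableSet (B i)) →
    (∀ i, B i ⊆ Set.Icc 0 1) → Pairwise (fun i j => Disjoint (B i) (B j)) →
    ProbabilityTheory.iIndepFun (fun i ω => pointCount (X ω) (B i)) μ

/-! ### The random geometric graph and its hop counts -/

/-- The hard geometric graph on the vertex set `V` of reals: distinct vertices are joined when they
are at distance less than `r`. -/
def hardGeometricGraph (r : ℝ) (V : Set ℝ) : SimpleGraph V where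
  Adj x y := x ≠ y ∧ |(x : ℝ) - y| < r
  symm := ⟨fun x y h => ⟨h.1.symm, by rw [abs_sub_comm]; exact h.2⟩⟩
  loopless := ⟨fun _ h => h.1 rfl⟩

/-- The points of the configuration `P`, together with the two endpoints of `[0,1]`. -/
def rggVertices (P : Finset ℝ) : Set ℝ := (P : Set ℝ) ∪ {0, 1}

/-- The vertex `0`. -/
def rggLeft (P : Finset ℝ) : rggVertices P := ⟨0, by simp [rggVertices]⟩

/-- The vertex `1`. -/
def rggRight (P : Finset ℝ) : rggVertices P := ⟨1, by simp [rggVertices]⟩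

/-- `σ_k`: the number of paths with exactly `k` edges between the vertices `0` and `1`. -/
noncomputable def hopPathCount (r : ℝ) (k : ℕ) (P : Finset ℝ) : ℕ :=
  Nat.card {p : (hardGeometricGraph r (rggVertices P)).Walk (rggLeft P) (rggRight P) //
    p.IsPath ∧ p.length = k}

/-- The lens `L_j`, for `1 ≤ j ≤ k - 1`. -/
def lens (k : ℕ) (r : ℝ) (j : ℕ) : Set ℝ :=
  Metric.ball (0 : ℝ) (j * r) ∩ Metric.ball (1 : ℝ) (((k : ℝ) - j) * r)

/-- The event that the lens `L_j` holds exactly `m j` points, for every `1 ≤ j ≤ k - 1`. -/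
def lensEvent {Ω : Type*} (X : Ω → Finset ℝ) (k : ℕ) (r : ℝ) (m : ℕ → ℕ) : Set Ω :=
  {ω | ∀ j ∈ Finset.Icc 1 (k - 1), pointCount (X ω) (lens k r j) = m j}

/-! ### Lattice paths -/

/-- The lattice paths from the origin to `(m i)_{i ∈ I}` with steps in `{e_i : i ∈ I}`, a path being
the list of the indices of its successive steps. -/
def latticePaths (I : Finset ℕ) (m : ℕ → ℕ) : Finset (List ℕ) :=
  (Multiset.lists (∑ i ∈ I, Multiset.replicate (m i) i)).toFinset

theorem mem_latticePaths {I : Finset ℕ} {m : ℕ → ℕ} {w : List ℕ} :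
    w ∈ latticePaths I m ↔ (∀ i ∈ w, i ∈ I) ∧ ∀ i ∈ I, w.count i = m i := by
  have key : ∀ i, Multiset.count i (∑ j ∈ I, Multiset.replicate (m j) j)
      = if i ∈ I then m i else 0 := by
    intro i
    simp [Multiset.count_sum', Multiset.count_replicate]
  have h0 : w ∈ latticePaths I m ↔ (∑ i ∈ I, Multiset.replicate (m i) i) = (w : Multiset ℕ) := by
    rw [latticePaths, Multiset.mem_toFinset]
    exact Multiset.mem_lists_iff _ _
  rw [h0, Multiset.ext]
  simp only [key, Multiset.coe_count]
  constructor
  · intro h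
    refine ⟨fun i hi => ?_, fun i hi => by simpa [hi] using (h i).symm⟩
    by_contra hI
    have := h i
    simp [hI] at this
    exact (List.count_pos_iff.2 hi).ne this
  · rintro ⟨h1, h2⟩ i
    by_cases hi : i ∈ I
    · simp [hi, h2 i hi]
    · simp only [hi, if_false]
      exact (List.count_eq_zero.2 fun h => hi (h1 i h)).symm

/-- The projection `Π_{i,j}` of a path onto the face spanned by `e_i` and `e_j`. -/
def projPath (i j : ℕ) (w : List ℕ) : List ℕ := w.filter fun x => x = i ∨ x = j

/-- The parts, from the first step `e_j` to the last, of the Ferrers diagram of a path with steps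
`e_i` and `e_j`: there is one part for each step `e_j`, the number of steps `e_i` before it. -/
def ferrersParts (i j : ℕ) : List ℕ → List ℕ
  | [] => []
  | x :: w => if x = j then 0 :: ferrersParts i j w else (ferrersParts i j w).map (· + 1)

/-- The partition `π_{i,j}` of a path. -/
def pathPartition (i j : ℕ) (w : List ℕ) : List ℕ := ferrersParts i j (projPath i j w)

/-- `π_{i,j}(t)`: the `t`-th part of `π_{i,j}`, for `t ≥ 1`. -/
def pathPart (i j : ℕ) (w : List ℕ) (t : ℕ) : ℕ := (pathPartition i j w).getD (t - 1) 0

/-- `π⋆_{i,j}(t)`: the number of parts of `π_{i,j}` that are equal to `t`. -/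
def pathMult (i j : ℕ) (w : List ℕ) (t : ℕ) : ℕ := (pathPartition i j w).count t

/-- `S_t` of a path in dimension `d ≥ 1`: `S_t = t` for `d = 1`, and for `d ≥ 2` the iterated sum of
the parts `π_{1,2}(i₁)` over `i_{d-1} ≤ t`, `i_{d-2} ≤ π_{d-1,d}(i_{d-1})`, …, `i₁ ≤ π_{2,3}(i₂)`.
(The value in dimension `0` is not used.) -/
def pathS (w : List ℕ) : ℕ → ℕ → ℕ
  | 0, _ => 0
  | 1, t => t
  | d + 2, t => ∑ i ∈ Finset.Icc 1 t, pathS w (d + 1) (pathPart (d + 1) (d + 2) w i)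

/-- `S(Π') · π⋆(Π)`, for a path `v = Π'` in the directions `1, …, d` and a path `w = Π` in the
directions `d` and `d + 1`. -/
def pathDot (m : ℕ → ℕ) (d : ℕ) (v w : List ℕ) : ℕ :=
  ∑ t ∈ Finset.range (m d + 1), pathS v d t * pathMult d (d + 1) w t

/-- The partition degeneracy of a path `v` in the directions `1, …, d` and a path `w` in the
directions `d` and `d + 1`. -/
def degeneracy (m : ℕ → ℕ) (d : ℕ) (v w : List ℕ) : ℕ :=
  ∏ t ∈ Finset.range (m d + 1),
    (pathMult d (d + 1) w t + ∑ l ∈ Finset.Icc 1 (d - 1), pathMult d l v t).choose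
      (pathMult d (d + 1) w t)

/-!
Write `ℓ = k * r₀ - 1`. The lens `L_j` is the interval `(j * r₀ - ℓ, j * r₀)`, and the lenses are
disjoint because `(k - 1) * r₀ < 1`. A walk with `k` edges from `0` to `1` never repeats a vertex,
since fewer edges do not reach `1`, and its `j`-th vertex is in `L_j`. If that vertex is
`j * r₀ - s_j`, then consecutive vertices are joined exactly when `s_1 < s_2 < ⋯ < s_{k-1}`. Read the
points of all lenses in the order of increasing `s`, and write down the number of the lens of each:
then `σ_k` is the number of subsequences `1, 2, …, k - 1` of the word obtained (`chainCount`).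
Points outside the lenses play no role.

*The word is uniformly distributed, given the lens counts.* Cut every lens into `N` cells of equal
length and call the union of the `c`-th cells of all lenses the `c`-th column. Off an event of
probability `O(1 / N)` each column has at most one point (`measureReal_not_sparseColumns_le`). Then
the configuration is described by a word of length `N` with a letter `0` for each empty column
(`HasPattern`), and it determines `σ_k` (`HasPattern.hopPathCount_eq`). By independence the
probability of such a pattern depends only on its letter counts (`measure_hasPattern`), and each word
with the given letter counts comes from the same number of patterns
(`card_latticePaths_insert_filter`). Hence all words have the same weight
(`exists_measure_inter_sparseColumns`), and `N → ∞` gives `multinomial_mul_measureReal`. Only outer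
measure is used for the event `σ_k = n`, so its measurability plays no role.

*The words with `n` chains.* `S_t` counts the chains `1, …, d` ending at one of the first `t` letters
`d` (`pathS_count`), so the number of chains `1, …, d + 1` of a word is `S(Π') · π⋆(Π)` for its
projections `Π'` off the direction `d + 1` and `Π` onto the directions `d, d + 1`
(`pathDot_eq_chainCount`). A word with given projections amounts to a shuffle, in each slot between
consecutive letters `d`, of the letters `d + 1` with the letters below `d`; this is the product of
binomial coefficients (`encard_mergeSet`). Summation over the projections gives
`card_filter_chainCount`.
-/

/-! ### Chains in a word -/

/-- The number of occurrences of `1, 2, …, j` as a (not necessarily contiguous) subsequence of the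
word `w`, by recursion on the place of the last letter `j`. -/
def chainCount : ℕ → List ℕ → ℕ
  | 0, _ => 1
  | j + 1, w => ∑ i ∈ Finset.range w.length,
      if w.getD i 0 = j + 1 then chainCount j (w.take i) else 0

theorem chainCount_take (j : ℕ) {w : List ℕ} {c : ℕ} (hc : c ≤ w.length) :
    chainCount (j + 1) (w.take c) = ∑ i ∈ Finset.range c,
      if w.getD i 0 = j + 1 then chainCount j (w.take i) else 0 := by
  rw [chainCount, List.length_take, min_eq_left hc]
  refine Finset.sum_congr rfl fun i hi => ?_
  have hi := Finset.mem_range.1 hi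
  have h1 : (w.take c).getD i 0 = w.getD i 0 := by
    simp [List.getD_eq_getElem?_getD, hi]
  rw [h1, List.take_take, min_eq_left hi.le]

theorem chainCount_concat (j : ℕ) (w : List ℕ) (x : ℕ) :
    chainCount (j + 1) (w ++ [x]) =
      chainCount (j + 1) w + if x = j + 1 then chainCount j w else 0 := by
  have h := chainCount_take j (w := w ++ [x]) (c := w.length) (by simp)
  rw [List.take_left] at h
  rw [h]
  conv_lhs => rw [chainCount, List.length_append, List.length_singleton, Finset.sum_range_succ]
  simp

theorem chainCount_filter (p : ℕ → Bool) (w : List ℕ) (j : ℕ) (hp : ∀ i, 1 ≤ i → i ≤ j → p i) :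
    chainCount j (w.filter p) = chainCount j w := by
  induction w using List.reverseRecOn generalizing j with
  | nil => simp
  | append_singleton w x ih =>
    cases j with
    | zero => simp [chainCount]
    | succ j =>
      rw [List.filter_append, chainCount_concat, ← ih _ hp,
        ← ih j fun i h1 h2 => hp i h1 (h2.trans j.le_succ)]
      by_cases hx : p x = true
      · simp [hx, chainCount_concat]
      · have : x ≠ j + 1 := by
          rintro rfl
          exact hx (hp _ (by omega) le_rfl)
        simp [hx, this]

/-! ### The partitions of a lattice path -/

theorem pathPartition_nil (i j : ℕ) : pathPartition i j [] = [] := rfl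

theorem pathPartition_cons {i j : ℕ} (hij : i ≠ j) (x : ℕ) (w : List ℕ) :
    pathPartition i j (x :: w) = if x = j then 0 :: pathPartition i j w
      else if x = i then (pathPartition i j w).map (· + 1) else pathPartition i j w := by
  unfold pathPartition projPath
  by_cases h1 : x = j
  · simp [h1, ferrersParts]
  · by_cases h2 : x = i
    · simp [h2, ferrersParts, hij]
    · simp [h1, h2]

/-- Reading a path forwards, each step `e_j` adds the part that counts the steps `e_i` made so
far. -/
theorem pathPartition_concat {i j : ℕ} (hij : i ≠ j) (w : List ℕ) (x : ℕ) :
    pathPartition i j (w ++ [x]) =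
      pathPartition i j w ++ if x = j then [w.count i] else [] := by
  induction w with
  | nil =>
    rw [List.nil_append, pathPartition_cons hij]
    split_ifs <;> simp [pathPartition_nil]
  | cons y w ih =>
    rw [List.cons_append, pathPartition_cons hij, ih, pathPartition_cons hij]
    by_cases hx : x = j <;> by_cases hy : y = j <;> by_cases hy' : y = i <;>
      simp_all

theorem length_pathPartition {i j : ℕ} (hij : i ≠ j) (w : List ℕ) :
    (pathPartition i j w).length = w.count j := by
  induction w using List.reverseRecOn with
  | nil => rfl
  | append_singleton w x ih =>
    rw [pathPartition_concat hij]
    by_cases hx : x = j <;> simp [hx, ih]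

theorem le_count_of_mem_pathPartition {i j : ℕ} (hij : i ≠ j) {w : List ℕ} {t : ℕ}
    (ht : t ∈ pathPartition i j w) : t ≤ w.count i := by
  induction w using List.reverseRecOn with
  | nil => simp [pathPartition_nil] at ht
  | append_singleton w x ih =>
    rw [pathPartition_concat hij, List.mem_append] at ht
    rw [List.count_append]
    rcases ht with ht | ht
    · exact (ih ht).trans (Nat.le_add_right _ _)
    · split_ifs at ht <;> simp_all

theorem pathPartition_append {i j : ℕ} (hij : i ≠ j) (u v : List ℕ) :
    pathPartition i j u <+: pathPartition i j (u ++ v) := by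
  induction v using List.reverseRecOn with
  | nil => simp
  | append_singleton v x ih =>
    rw [← List.append_assoc, pathPartition_concat hij]
    exact ih.trans (List.prefix_append _ _)

theorem pathPart_append_cons {i j : ℕ} (hij : i ≠ j) (u v : List ℕ) :
    pathPart i j (u ++ j :: v) (u.count j + 1) = u.count i := by
  have h := pathPartition_append hij (u ++ [j]) v
  rw [pathPartition_concat hij, List.append_assoc, List.singleton_append] at h
  obtain ⟨s, hs⟩ := h
  rw [pathPart, ← hs, ← length_pathPartition hij]
  simp

theorem projPath_idem (i j : ℕ) (w : List ℕ) : projPath i j (projPath i j w) = projPath i j w := by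
  simp [projPath]

theorem pathPartition_filter {i j : ℕ} {p : ℕ → Bool} (hi : p i) (hj : p j) (w : List ℕ) :
    pathPartition i j (w.filter p) = pathPartition i j w := by
  unfold pathPartition projPath
  rw [List.filter_filter]
  congr 1
  refine List.filter_congr fun x _ => ?_
  by_cases h1 : x = i <;> by_cases h2 : x = j <;> simp_all

/-! ### The iterated sums count chains -/

/-- `S_t` of a path counts the chains `1, 2, …, d` that end at one of the first `t` steps `e_d`. -/
theorem pathS_count (d : ℕ) (u v : List ℕ) :
    pathS (u ++ v) (d + 1) (u.count (d + 1)) = chainCount (d + 1) u := by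
  induction d generalizing u v with
  | zero =>
    simp only [pathS, zero_add]
    induction u using List.reverseRecOn generalizing v with
    | nil => simp [chainCount]
    | append_singleton u x ih =>
      rw [chainCount_concat, ← ih v]
      by_cases hx : x = 1 <;> simp [hx, chainCount]
  | succ d ih =>
    induction u using List.reverseRecOn generalizing v with
    | nil => simp [pathS, chainCount]
    | append_singleton u x ih' =>
      rw [chainCount_concat, ← ih' (x :: v), List.append_assoc, List.singleton_append,
        List.count_append]
      by_cases hx : x = d + 1 + 1
      · subst hx
        rw [List.count_singleton_self, if_pos rfl]
        simp only [pathS]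
        rw [Finset.sum_Icc_succ_top (by omega), pathPart_append_cons (by omega), ih]
      · simp [hx]

theorem pathS_filter {p : ℕ → Bool} (w : List ℕ) (d t : ℕ) (hp : ∀ i, 1 ≤ i → i ≤ d → p i) :
    pathS (w.filter p) d t = pathS w d t := by
  induction d generalizing t with
  | zero => rfl
  | succ d ih =>
    cases d with
    | zero => rfl
    | succ d =>
      simp only [pathS, pathPart]
      rw [pathPartition_filter (hp _ (by omega) (by omega)) (hp _ (by omega) le_rfl)]
      exact Finset.sum_congr rfl fun i _ => ih _ fun i h1 h2 => hp i h1 (by omega)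

theorem sum_map_pathPartition (d : ℕ) (u v : List ℕ) :
    ((pathPartition (d + 1) (d + 2) u).map (pathS (u ++ v) (d + 1))).sum =
      chainCount (d + 2) u := by
  induction u using List.reverseRecOn generalizing v with
  | nil => simp [pathPartition_nil, chainCount]
  | append_singleton u x ih =>
    rw [chainCount_concat, ← ih (x :: v), pathPartition_concat (by omega), List.append_assoc,
      List.singleton_append]
    by_cases hx : x = d + 1 + 1
    · simp [hx, pathS_count]
    · simp [hx]

/-- The scalar product `S(Π') · π⋆(Π)` of the two projections of a word is its number of full
chains. -/
theorem pathDot_eq_chainCount {m : ℕ → ℕ} {d : ℕ} {W : List ℕ} {p : ℕ → Bool}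
    (hp : ∀ i, 1 ≤ i → i ≤ d + 1 → p i) (hm : W.count (d + 1) = m (d + 1)) :
    pathDot m (d + 1) (W.filter p) (projPath (d + 1) (d + 2) W) = chainCount (d + 2) W := by
  have h := sum_map_pathPartition d W []
  rw [List.append_nil] at h
  rw [← h, Finset.sum_list_map_count]
  have hpp : pathPartition (d + 1) (d + 2) (projPath (d + 1) (d + 2) W) =
      pathPartition (d + 1) (d + 2) W := by
    rw [pathPartition, projPath_idem, ← pathPartition]
  simp only [pathDot, pathMult, hpp]
  symm
  refine (Finset.sum_subset (fun t ht => ?_) fun t _ ht => ?_).trans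
    (Finset.sum_congr rfl fun t _ => ?_)
  · have := le_count_of_mem_pathPartition (by omega) (List.mem_toFinset.1 ht)
    exact Finset.mem_range.2 (by omega)
  · rw [List.mem_toFinset] at ht
    simp [List.count_eq_zero.2 ht]
  · rw [pathS_filter W _ _ hp, smul_eq_mul, mul_comm]

/-! ### Counting words with prescribed projections -/

theorem encard_image_cons (a : ℕ) (s : Set (List ℕ)) : ((a :: ·) '' s).encard = s.encard :=
  (List.cons_injective).encard_image s

theorem disjoint_image_cons {a b : ℕ} (hab : a ≠ b) (s t : Set (List ℕ)) :
    Disjoint ((a :: ·) '' s) ((b :: ·) '' t) := by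
  rw [Set.disjoint_left]
  rintro _ ⟨x, _, rfl⟩ ⟨y, _, h⟩
  exact hab (List.cons.inj h).1.symm

/-- Inserting `p` letters `a` into a word `v` that does not contain `a`. -/
theorem encard_filter_ne_eq (a : ℕ) (v : List ℕ) (p : ℕ) (hv : a ∉ v) :
    {g : List ℕ | g.filter (· ≠ a) = v ∧ g.count a = p}.encard = (v.length + p).choose p := by
  induction v generalizing p with
  | nil =>
    have : {g : List ℕ | g.filter (· ≠ a) = [] ∧ g.count a = p} = {List.replicate p a} := by
      ext g
      simp only [Set.mem_ofPred_eq, Set.mem_singleton_iff, List.eq_replicate_iff,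
        List.filter_eq_nil_iff, decide_eq_true_eq, not_not]
      constructor
      · rintro ⟨h1, h2⟩
        rw [List.count_eq_length.2 fun b hb => (h1 b hb).symm] at h2
        exact ⟨h2, h1⟩
      · rintro ⟨h1, h2⟩
        exact ⟨h2, by rw [List.count_eq_length.2 fun b hb => (h2 b hb).symm, h1]⟩
    rw [this]
    simp
  | cons b v ih =>
    have hba : b ≠ a := fun h => hv (by simp [h])
    have hv' : a ∉ v := fun h => hv (by simp [h])
    induction p with
    | zero =>
      have : {g : List ℕ | g.filter (· ≠ a) = b :: v ∧ g.count a = 0} = {b :: v} := by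
        ext g
        simp only [Set.mem_ofPred_eq, Set.mem_singleton_iff, List.count_eq_zero]
        constructor
        · rintro ⟨h1, h2⟩
          rw [← h1, eq_comm, List.filter_eq_self]
          exact fun x hx => decide_eq_true (by rintro rfl; exact h2 hx)
        · rintro rfl
          refine ⟨?_, hv⟩
          rw [List.filter_eq_self]
          exact fun x hx => decide_eq_true (by rintro rfl; exact hv hx)
      rw [this]
      simp
    | succ p ihp =>
      have : {g : List ℕ | g.filter (· ≠ a) = b :: v ∧ g.count a = p + 1} =
          (a :: ·) '' {g : List ℕ | g.filter (· ≠ a) = b :: v ∧ g.count a = p} ∪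
          (b :: ·) '' {g : List ℕ | g.filter (· ≠ a) = v ∧ g.count a = p + 1} := by
        ext g
        cases g with
        | nil => simp
        | cons x g =>
          by_cases hx : x = a
          · subst hx; simp [hba]
          · by_cases hxb : x = b
            · subst hxb; simp [hx, Ne.symm hx]
            · simp [hx, hxb, Ne.symm hxb, Ne.symm hx]
      rw [this, Set.encard_union_eq (disjoint_image_cons hba.symm _ _), encard_image_cons,
        encard_image_cons, ihp, ih _ hv', List.length_cons]
      norm_cast
      rw [show v.length + 1 + (p + 1) = (v.length + 1 + p) + 1 by ring, Nat.choose_succ_succ,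
        show v.length + (p + 1) = v.length + 1 + p by ring]

theorem pathMult_cons {i j : ℕ} (hij : i ≠ j) (x : ℕ) (w : List ℕ) (t : ℕ) :
    pathMult i j (x :: w) t =
      if x = i then (if t = 0 then 0 else pathMult i j w (t - 1))
      else pathMult i j w t + if x = j ∧ t = 0 then 1 else 0 := by
  rw [pathMult, pathPartition_cons hij]
  by_cases h1 : x = i
  · subst h1
    rw [if_neg hij, if_pos rfl, if_pos rfl]
    cases t with
    | zero => simp [List.count_eq_zero]
    | succ t => simp [pathMult, List.count_map_of_injective _ _ (add_left_injective 1)]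
  · by_cases h2 : x = j
    · subst h2
      simp [h1, pathMult, List.count_cons, eq_comm (a := 0)]
    · simp [h1, h2, pathMult]

/-- The number of letters of `v` in `1, …, d - 1` that come after exactly `t` letters `d`. -/
def lowerMult (d : ℕ) (v : List ℕ) (t : ℕ) : ℕ := ∑ l ∈ Finset.Icc 1 (d - 1), pathMult d l v t

theorem lowerMult_nil (d t : ℕ) : lowerMult d [] t = 0 := by
  simp [lowerMult, pathMult, pathPartition_nil]

theorem lowerMult_cons_self (d : ℕ) (v : List ℕ) (t : ℕ) :
    lowerMult d (d :: v) t = if t = 0 then 0 else lowerMult d v (t - 1) := by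
  have h : ∀ l ∈ Finset.Icc 1 (d - 1), pathMult d l (d :: v) t =
      if t = 0 then 0 else pathMult d l v (t - 1) := by
    intro l hl
    rw [pathMult_cons (by grind), if_pos rfl]
  rw [lowerMult, Finset.sum_congr rfl h]
  split_ifs <;> simp [lowerMult]

theorem lowerMult_cons_of_mem {d x : ℕ} (hx : x ∈ Finset.Icc 1 (d - 1)) (v : List ℕ) (t : ℕ) :
    lowerMult d (x :: v) t = lowerMult d v t + if t = 0 then 1 else 0 := by
  have h : ∀ l ∈ Finset.Icc 1 (d - 1), pathMult d l (x :: v) t =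
      pathMult d l v t + if x = l then (if t = 0 then 1 else 0) else 0 := by
    intro l hl
    rw [pathMult_cons (by grind), if_neg (by grind)]
    by_cases h1 : x = l <;> simp [h1]
  rw [lowerMult, Finset.sum_congr rfl h, Finset.sum_add_distrib, Finset.sum_ite_eq, if_pos hx,
    lowerMult]

/-- The words whose projection off the direction `d + 1` is `v` and whose projection onto the
directions `d` and `d + 1` is `w`. -/
def mergeSet (d : ℕ) (v w : List ℕ) : Set (List ℕ) :=
  {W | W.filter (· ≠ d + 1) = v ∧ projPath d (d + 1) W = w}

theorem encard_mergeSet_nil {d : ℕ} {w : List ℕ} (hw : ∀ x ∈ w, x = d + 1) :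
    (mergeSet d [] w).encard = 1 := by
  have : mergeSet d [] w = {w} := by
    ext W
    simp only [mergeSet, projPath, Set.mem_ofPred_eq, Set.mem_singleton_iff,
      List.filter_eq_nil_iff, decide_eq_true_eq, not_not]
    constructor
    · rintro ⟨h1, rfl⟩
      rw [eq_comm, List.filter_eq_self]
      exact fun x hx => decide_eq_true (Or.inr (h1 x hx))
    · rintro rfl
      rw [List.filter_eq_self]
      exact ⟨hw, fun x hx => decide_eq_true (Or.inr (hw x hx))⟩
  simp [this]

theorem encard_mergeSet_nil_right {d : ℕ} {v : List ℕ} (hv : ∀ x ∈ v, x ≠ d ∧ x ≠ d + 1) :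
    (mergeSet d v []).encard = 1 := by
  have : mergeSet d v [] = {v} := by
    ext W
    simp only [mergeSet, projPath, Set.mem_ofPred_eq, Set.mem_singleton_iff,
      List.filter_eq_nil_iff, decide_eq_true_eq, not_or]
    constructor
    · rintro ⟨rfl, h1⟩
      rw [eq_comm, List.filter_eq_self]
      exact fun x hx => decide_eq_true (h1 x hx).2
    · rintro rfl
      rw [List.filter_eq_self]
      exact ⟨fun x hx => decide_eq_true (hv x hx).2, hv⟩
  simp [this]

/-- Between two consecutive letters `d`, the letters `d + 1` of `w` and the letters below `d` of `v`
are shuffled arbitrarily; a binomial coefficient counts the shuffles of each slot. -/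
theorem encard_mergeSet {d : ℕ} (v w : List ℕ) (hv : ∀ x ∈ v, x ∈ Finset.Icc 1 d)
    (hw : ∀ x ∈ w, x = d ∨ x = d + 1) (hvw : v.count d = w.count d) :
    (mergeSet d v w).encard = ((∏ t ∈ Finset.range (v.count d + 1),
      (pathMult d (d + 1) w t + lowerMult d v t).choose (pathMult d (d + 1) w t) : ℕ) : ℕ∞) := by
  have hd : d ≠ d + 1 := by omega
  induction v generalizing w with
  | nil =>
    rw [encard_mergeSet_nil]
    · simp [lowerMult_nil]
    · intro x hx
      refine (hw x hx).resolve_left ?_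
      rintro rfl
      exact List.count_eq_zero.1 hvw.symm hx
  | cons a v ih =>
    have hv' : ∀ x ∈ v, x ∈ Finset.Icc 1 d := fun x hx => hv x (by simp [hx])
    have ha : a ∈ Finset.Icc 1 d := hv a (by simp)
    have had : a ≠ d + 1 := by grind
    induction w with
    | nil =>
      rw [encard_mergeSet_nil_right]
      · simp [pathMult, pathPartition_nil]
      · intro x hx
        refine ⟨?_, by grind⟩
        rintro rfl
        exact List.count_eq_zero.1 hvw hx
    | cons b w ihw =>
      have hw' : ∀ x ∈ w, x = d ∨ x = d + 1 := fun x hx => hw x (by simp [hx])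
      by_cases hb : b = d
      · subst hb
        by_cases hab : a = b
        · subst hab
          have : mergeSet a (a :: v) (a :: w) = (a :: ·) '' mergeSet a v w := by
            ext W
            cases W with
            | nil => simp [mergeSet]
            | cons x W =>
              by_cases hx : x = a
              · subst hx; simp [mergeSet, projPath]
              · by_cases hx' : x = a + 1
                · subst hx'; simp [mergeSet, projPath]
                · simp [mergeSet, projPath, hx, Ne.symm hx, hx']
          rw [this, encard_image_cons, ih w hv' hw' (by simpa using hvw), List.count_cons_self,
            Finset.prod_range_succ' _ (v.count a + 1)]
          simp [pathMult_cons hd, lowerMult_cons_self]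
        · have hm : a ∈ Finset.Icc 1 (b - 1) := by grind
          have : mergeSet b (a :: v) (b :: w) = (a :: ·) '' mergeSet b v (b :: w) := by
            ext W
            cases W with
            | nil => simp [mergeSet]
            | cons x W =>
              by_cases hx : x = a
              · subst hx; simp [mergeSet, projPath, hab, had]
              · by_cases hx' : x = b + 1
                · subst hx'
                  simp only [mergeSet, projPath]
                  simp [had]
                · simp [mergeSet, hx, Ne.symm hx, hx']
          have hab' : (a == b) = false := by simpa using hab
          rw [List.count_cons, hab'] at hvw ⊢
          rw [this, encard_image_cons, ih _ hv' hw (by simpa using hvw)]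
          simp only [Bool.false_eq_true, if_false, add_zero]
          rw [Finset.prod_range_succ' _ (v.count b), Finset.prod_range_succ' _ (v.count b)]
          simp [pathMult_cons hd, lowerMult_cons_of_mem hm]
      · obtain rfl : b = d + 1 := (hw b (by simp)).resolve_left hb
        have hvw' : (a :: v).count d = w.count d := by simpa using hvw
        by_cases hab : a = d
        · subst hab
          have : mergeSet a (a :: v) ((a + 1) :: w) = ((a + 1) :: ·) '' mergeSet a (a :: v) w := by
            ext W
            cases W with
            | nil => simp [mergeSet]
            | cons x W =>
              by_cases hx : x = a
              · subst hx; simp [mergeSet, projPath]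
              · by_cases hx' : x = a + 1
                · subst hx'; simp [mergeSet, projPath]
                · simp [mergeSet, hx, Ne.symm hx', hx']
          rw [this, encard_image_cons, ihw hw' hvw', List.count_cons_self,
            Finset.prod_range_succ' _ (v.count a + 1), Finset.prod_range_succ' _ (v.count a + 1)]
          simp [pathMult_cons hd, lowerMult_cons_self]
        · have hm : a ∈ Finset.Icc 1 (d - 1) := by grind
          have : mergeSet d (a :: v) ((d + 1) :: w) =
              (a :: ·) '' mergeSet d v ((d + 1) :: w) ∪
                ((d + 1) :: ·) '' mergeSet d (a :: v) w := by
            ext W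
            cases W with
            | nil => simp [mergeSet]
            | cons x W =>
              by_cases hx : x = a
              · subst hx; simp [mergeSet, projPath, hab, had, Ne.symm had]
              · by_cases hx' : x = d + 1
                · subst hx'; simp [mergeSet, projPath, had]
                · simp [mergeSet, hx, Ne.symm hx, hx', Ne.symm hx']
          have hab' : (a == d) = false := by simpa using hab
          have hc : (a :: v).count d = v.count d := by simp [List.count_cons, hab']
          rw [this, Set.encard_union_eq (disjoint_image_cons had _ _), encard_image_cons,
            encard_image_cons, ihw hw' hvw', ih _ hv' hw (by rw [← hc, hvw]), hc]
          norm_cast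
          rw [Finset.prod_range_succ' _ (v.count d), Finset.prod_range_succ' _ (v.count d),
            Finset.prod_range_succ' _ (v.count d)]
          simp only [pathMult_cons hd, lowerMult_cons_of_mem hm, Nat.add_eq_zero_iff, one_ne_zero,
            and_false, if_false, if_true, and_self, add_zero, Nat.succ_ne_self]
          rw [← mul_add]
          congr 1
          rw [show ∀ p q : ℕ, p + 1 + (q + 1) = (p + q + 1) + 1 by intros; ring,
            Nat.choose_succ_succ, add_comm (Nat.choose _ _)]
          congr 2; ring

theorem length_of_mem_latticePaths {I : Finset ℕ} {m : ℕ → ℕ} {w : List ℕ}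
    (hw : w ∈ latticePaths I m) : w.length = ∑ i ∈ I, m i := by
  have h : (∑ i ∈ I, Multiset.replicate (m i) i) = (w : Multiset ℕ) := by
    rw [latticePaths, Multiset.mem_toFinset] at hw
    exact (Multiset.mem_lists_iff _ _).1 hw
  rw [← Multiset.coe_card, ← h]
  simp

/-- A lattice path in the directions `insert a I` is a lattice path in the directions `I` together
with the places of the steps `e_a`. -/
theorem card_latticePaths_insert_filter {I : Finset ℕ} {a : ℕ} (ha : a ∉ I) (m : ℕ → ℕ)
    {S : Finset (List ℕ)} (hS : S ⊆ latticePaths I m) :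
    ((latticePaths (insert a I) m).filter fun g => g.filter (· ≠ a) ∈ S).card =
      (m a + ∑ i ∈ I, m i).choose (m a) * S.card := by
  rw [Finset.card_eq_sum_card_fiberwise
    (s := (latticePaths (insert a I) m).filter fun g => g.filter (· ≠ a) ∈ S)
    (f := fun g : List ℕ => g.filter (· ≠ a)) (t := S)
    (fun g hg => (Finset.mem_filter.1 hg).2), mul_comm, ← smul_eq_mul]
  refine Finset.sum_eq_card_nsmul fun v hv => ?_
  have hvI := mem_latticePaths.1 (hS hv)
  have hav : a ∉ v := fun h => ha (hvI.1 a h)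
  have h := encard_filter_ne_eq a v (m a) hav
  rw [length_of_mem_latticePaths (hS hv), add_comm] at h
  rw [← ENat.natCast_inj, ← h, ← Set.encard_coe_eq_coe_finsetCard]
  congr 1
  ext g
  simp only [Finset.coe_filter, Finset.mem_filter, Set.mem_ofPred_eq, mem_latticePaths]
  constructor
  · rintro ⟨⟨⟨-, h2⟩, -⟩, h3⟩
    exact ⟨h3, h2 a (Finset.mem_insert_self _ _)⟩
  · rintro ⟨h1, h2⟩
    refine ⟨⟨⟨fun i hi => ?_, fun i hi => ?_⟩, h1 ▸ hv⟩, h1⟩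
    · by_cases hia : i = a
      · simp [hia]
      · exact Finset.mem_insert_of_mem (hvI.1 i (by
          rw [← h1, List.mem_filter]; exact ⟨hi, decide_eq_true hia⟩))
    · rcases Finset.mem_insert.1 hi with rfl | hi
      · exact h2
      · rw [← hvI.2 i hi, ← h1, List.count_filter]
        exact decide_eq_true (ne_of_mem_of_not_mem hi ha)

theorem filter_ne_mem_latticePaths {I : Finset ℕ} {a : ℕ} (ha : a ∉ I) {m : ℕ → ℕ} {g : List ℕ}
    (hg : g ∈ latticePaths (insert a I) m) : g.filter (· ≠ a) ∈ latticePaths I m := by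
  rw [mem_latticePaths] at hg ⊢
  refine ⟨fun i hi => ?_, fun i hi => ?_⟩
  · rw [List.mem_filter] at hi
    exact (Finset.mem_insert.1 (hg.1 i hi.1)).resolve_left (of_decide_eq_true hi.2)
  · rw [List.count_filter, hg.2 i (Finset.mem_insert_of_mem hi)]
    exact decide_eq_true (by rintro rfl; exact ha hi)

theorem card_latticePaths (I : Finset ℕ) (m : ℕ → ℕ) :
    (latticePaths I m).card = Nat.multinomial I m := by
  induction I using Finset.induction_on with
  | empty =>
    have : latticePaths ∅ m = {[]} := by
      ext w
      simp [mem_latticePaths, List.eq_nil_iff_forall_not_mem]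
    simp [this]
  | insert a I ha ih =>
    rw [Nat.multinomial_insert ha, ← ih, ← card_latticePaths_insert_filter ha m subset_rfl,
      Finset.filter_true_of_mem fun g hg => filter_ne_mem_latticePaths ha hg]

theorem projPath_mem_latticePaths {I : Finset ℕ} {m : ℕ → ℕ} {W : List ℕ} {i j : ℕ}
    (hi : i ∈ I) (hj : j ∈ I) (hW : W ∈ latticePaths I m) :
    projPath i j W ∈ latticePaths {i, j} m := by
  rw [mem_latticePaths] at hW ⊢
  refine ⟨fun l hl => ?_, fun l hl => ?_⟩
  · simpa using of_decide_eq_true (List.mem_filter.1 hl).2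
  · have hl' : l = i ∨ l = j := by simpa using hl
    rw [projPath, List.count_filter (by exact decide_eq_true hl')]
    exact hW.2 l (by rcases hl' with rfl | rfl <;> assumption)

/-- The words with `n` full chains, grouped by their projections onto the directions `1, …, d + 1`
and onto the directions `d + 1, d + 2`. -/
theorem card_filter_chainCount (m : ℕ → ℕ) (d n : ℕ) :
    ((latticePaths (Finset.Icc 1 (d + 2)) m).filter fun W => chainCount (d + 2) W = n).card =
      ∑ v ∈ latticePaths (Finset.Icc 1 (d + 1)) m,
        ∑ w ∈ latticePaths {d + 1, d + 2} m with pathDot m (d + 1) v w = n,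
          degeneracy m (d + 1) v w := by
  have hI : Finset.Icc 1 (d + 2) = insert (d + 2) (Finset.Icc 1 (d + 1)) := by
    ext i; simp only [Finset.mem_insert, Finset.mem_Icc]; omega
  have hdI : d + 2 ∉ Finset.Icc 1 (d + 1) := by simp
  have hdot : ∀ W ∈ latticePaths (Finset.Icc 1 (d + 2)) m,
      pathDot m (d + 1) (W.filter (· ≠ d + 2)) (projPath (d + 1) (d + 2) W) =
        chainCount (d + 2) W := fun W hW =>
    pathDot_eq_chainCount (fun i _ h2 => decide_eq_true (by omega))
      ((mem_latticePaths.1 hW).2 _ (by simp))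
  simp_rw [Finset.sum_filter]
  rw [← Finset.sum_product' _ _ (fun v w => if pathDot m (d + 1) v w = n then
    degeneracy m (d + 1) v w else 0), Finset.card_eq_sum_card_fiberwise
      (f := fun W : List ℕ => (W.filter (· ≠ d + 2), projPath (d + 1) (d + 2) W))
      (t := latticePaths (Finset.Icc 1 (d + 1)) m ×ˢ latticePaths {d + 1, d + 2} m)]
  · refine Finset.sum_congr rfl fun ⟨v, w⟩ hvw => ?_
    obtain ⟨hv, hw⟩ := Finset.mem_product.1 hvw
    have hv' := mem_latticePaths.1 hv
    have hw' := mem_latticePaths.1 hw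
    dsimp only at hv' hw' ⊢
    split_ifs with hn
    · have h := encard_mergeSet v w hv'.1 (fun x hx => by simpa using hw'.1 x hx)
        (by rw [hv'.2 _ (by simp), hw'.2 _ (by simp)])
      rw [hv'.2 _ (by simp)] at h
      rw [← ENat.natCast_inj, ← Set.encard_coe_eq_coe_finsetCard]
      refine Eq.trans ?_ h
      congr 1
      ext W
      simp only [Finset.coe_filter, Finset.mem_filter, Set.mem_ofPred_eq, Prod.mk.injEq, mergeSet]
      constructor
      · exact fun h => h.2
      · rintro ⟨h1, h2⟩
        have hW : W ∈ latticePaths (Finset.Icc 1 (d + 2)) m := by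
          rw [mem_latticePaths]
          refine ⟨fun i hi => ?_, fun i hi => ?_⟩
          · by_cases hid : i = d + 2
            · simp [hid]
            · rw [hI]
              refine Finset.mem_insert_of_mem (hv'.1 i ?_)
              rw [← h1, List.mem_filter]
              exact ⟨hi, decide_eq_true hid⟩
          · by_cases hid : i = d + 2
            · subst hid
              rw [← hw'.2 (d + 2) (by simp), ← h2, projPath, List.count_filter]
              simp
            · rw [hI] at hi
              rw [← hv'.2 i ((Finset.mem_insert.1 hi).resolve_left hid), ← h1, List.count_filter]
              exact decide_eq_true hid
        exact ⟨⟨hW, by rw [← hdot W hW, h1, h2, hn]⟩, h1, h2⟩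
    · rw [Finset.card_eq_zero, Finset.filter_eq_empty_iff]
      intro W hW hWvw
      obtain ⟨hW, hWn⟩ := Finset.mem_filter.1 hW
      obtain ⟨rfl, rfl⟩ := Prod.mk.inj hWvw
      exact hn (by rw [hdot W hW, hWn])
  · intro W hW
    have hW := (Finset.mem_filter.1 hW).1
    refine Finset.mem_coe.2 (Finset.mem_product.2 ⟨?_, ?_⟩)
    · exact filter_ne_mem_latticePaths hdI (by rwa [← hI])
    · exact projPath_mem_latticePaths (by simp) (by simp) hW

/-! ### Lenses and cells -/

theorem pointCount_eq_card_filter (P : Finset ℝ) (B : Set ℝ) [DecidablePred (· ∈ B)] :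
    pointCount P B = (P.filter (· ∈ B)).card := by
  rw [pointCount, ← Set.ncard_coe_finset]
  congr 1
  ext x
  simp

theorem lens_eq_Ioo {k : ℕ} {r : ℝ} (h1 : 1 < k * r) (h2 : ((k : ℝ) - 1) * r < 1) {j : ℕ}
    (hj : j ∈ Finset.Icc 1 (k - 1)) : lens k r j = Set.Ioo (1 - ((k : ℝ) - j) * r) (j * r) := by
  obtain ⟨hj1, hj2⟩ := Finset.mem_Icc.1 hj
  have hj1' : (1 : ℝ) ≤ j := by exact_mod_cast hj1
  have hj2' : (j : ℝ) + 1 ≤ k := by exact_mod_cast (by omega : j + 1 ≤ k)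
  have hr : 0 < r := by nlinarith
  ext x
  simp only [lens, Set.mem_inter_iff, Metric.mem_ball, Real.dist_eq, abs_lt, Set.mem_Ioo]
  constructor
  · rintro ⟨⟨_, _⟩, _, _⟩
    constructor <;> linarith
  · rintro ⟨_, _⟩
    refine ⟨⟨?_, ?_⟩, ?_, ?_⟩ <;> nlinarith

theorem lens_subset_Ioo {k : ℕ} {r : ℝ} (h1 : 1 < k * r) (h2 : ((k : ℝ) - 1) * r < 1) {j : ℕ}
    (hj : j ∈ Finset.Icc 1 (k - 1)) : lens k r j ⊆ Set.Ioo 0 1 := by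
  rw [lens_eq_Ioo h1 h2 hj]
  obtain ⟨hj1, hj2⟩ := Finset.mem_Icc.1 hj
  have hj1' : (1 : ℝ) ≤ j := by exact_mod_cast hj1
  have hj2' : (j : ℝ) + 1 ≤ k := by exact_mod_cast (by omega : j + 1 ≤ k)
  have hr : 0 < r := by nlinarith
  exact Set.Ioo_subset_Ioo (by nlinarith) (by nlinarith)

theorem disjoint_lens {k : ℕ} {r : ℝ} (h1 : 1 < k * r) (h2 : ((k : ℝ) - 1) * r < 1) {i j : ℕ}
    (hi : i ∈ Finset.Icc 1 (k - 1)) (hj : j ∈ Finset.Icc 1 (k - 1)) (hij : i ≠ j) :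
    Disjoint (lens k r i) (lens k r j) := by
  wlog h : i < j generalizing i j
  · exact (this hj hi hij.symm (by omega)).symm
  rw [lens_eq_Ioo h1 h2 hi, lens_eq_Ioo h1 h2 hj, Set.disjoint_left]
  rintro x ⟨_, hx⟩ ⟨hx', _⟩
  have hk : (0 : ℝ) ≤ (k : ℝ) - 1 := by
    have : 1 ≤ k := by have := Finset.mem_Icc.1 hi; omega
    have : (1 : ℝ) ≤ k := by exact_mod_cast this
    linarith
  have hr : 0 < r := by nlinarith
  have h' : (i : ℝ) + 1 ≤ j := by exact_mod_cast h
  nlinarith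

/-- The column of a point `x` of the `j`-th lens, when each lens is cut into `N` cells of equal
length; columns are numbered from the right end of the lens. -/
noncomputable def lensCol (k : ℕ) (r : ℝ) (N j : ℕ) (x : ℝ) : ℕ :=
  ⌊(j * r - x) * N / (k * r - 1)⌋₊

/-- The cell of the `j`-th lens in column `c`. -/
def cell (k : ℕ) (r : ℝ) (N j c : ℕ) : Set ℝ := {x ∈ lens k r j | lensCol k r N j x = c}

theorem lensCol_lt {k : ℕ} {r : ℝ} (h1 : 1 < k * r) (h2 : ((k : ℝ) - 1) * r < 1) {N j : ℕ}
    (hN : 0 < N) (hj : j ∈ Finset.Icc 1 (k - 1)) {x : ℝ} (hx : x ∈ lens k r j) :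
    lensCol k r N j x < N := by
  rw [lens_eq_Ioo h1 h2 hj] at hx
  have hN' : (0 : ℝ) < N := by exact_mod_cast hN
  have hl : 0 < k * r - 1 := by linarith
  rw [lensCol, Nat.floor_lt (div_nonneg (mul_nonneg (by linarith [hx.2]) hN'.le) hl.le),
    div_lt_iff₀ hl, mul_comm]
  exact mul_lt_mul_of_pos_left (by linarith [hx.1]) hN'

/-- Cutting a lens into columns: a sum over the points of a lens of a function of the column. -/
theorem sum_lens_eq_sum_col {k : ℕ} {r : ℝ} (h1 : 1 < k * r) (h2 : ((k : ℝ) - 1) * r < 1)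
    {N j : ℕ} (hN : 0 < N) (hj : j ∈ Finset.Icc 1 (k - 1)) (P : Finset ℝ)
    [DecidablePred (· ∈ lens k r j)] (F : ℕ → ℕ) :
    ∑ y ∈ P with y ∈ lens k r j, F (lensCol k r N j y) =
      ∑ c ∈ Finset.range N, pointCount P (cell k r N j c) * F c := by
  classical
  rw [← Finset.sum_fiberwise_of_maps_to (t := Finset.range N) (g := lensCol k r N j)
    fun y hy => Finset.mem_range.2 (lensCol_lt h1 h2 hN hj (Finset.mem_filter.1 hy).2)]
  refine Finset.sum_congr rfl fun c _ => ?_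
  rw [Finset.sum_congr rfl fun y hy => by rw [(Finset.mem_filter.1 hy).2], Finset.sum_const,
    pointCount_eq_card_filter, Finset.filter_filter, smul_eq_mul]
  simp only [cell, Set.mem_sep_iff]

theorem pointCount_lens {k : ℕ} {r : ℝ} (h1 : 1 < k * r) (h2 : ((k : ℝ) - 1) * r < 1)
    {N j : ℕ} (hN : 0 < N) (hj : j ∈ Finset.Icc 1 (k - 1)) (P : Finset ℝ) :
    pointCount P (lens k r j) = ∑ c ∈ Finset.range N, pointCount P (cell k r N j c) := by
  classical
  have := sum_lens_eq_sum_col h1 h2 hN hj P fun _ => 1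
  simpa [pointCount_eq_card_filter P (lens k r j)] using this

/-- The configuration `P` has the pattern `g` when cutting the lenses into `g.length` columns: the
letter `j` at place `c` of `g` means that column `c` has exactly one point, which is in the `j`-th
lens, and a letter which is not the number of a lens means that column `c` has no points. -/
def HasPattern (k : ℕ) (r : ℝ) (g : List ℕ) (P : Finset ℝ) : Prop :=
  ∀ j ∈ Finset.Icc 1 (k - 1), ∀ c ∈ Finset.range g.length,
    pointCount P (cell k r g.length j c) = if g.getD c 0 = j then 1 else 0

theorem sum_range_getD_eq_count (g : List ℕ) (j : ℕ) :
    (∑ c ∈ Finset.range g.length, if g.getD c 0 = j then 1 else 0) = g.count j := by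
  induction g using List.reverseRecOn with
  | nil => simp
  | append_singleton g x ih =>
    rw [List.length_append, List.length_singleton, Finset.sum_range_succ, List.count_append, ← ih]
    congr 1
    · refine Finset.sum_congr rfl fun c hc => ?_
      simp [List.getD_eq_getElem?_getD, List.getElem?_append_left (Finset.mem_range.1 hc)]
    · by_cases hx : x = j <;> simp [hx]

theorem HasPattern.pointCount_lens {k : ℕ} {r : ℝ} (h1 : 1 < k * r) (h2 : ((k : ℝ) - 1) * r < 1)
    {g : List ℕ} (hg : 0 < g.length) {P : Finset ℝ} (hP : HasPattern k r g P) {j : ℕ}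
    (hj : j ∈ Finset.Icc 1 (k - 1)) : pointCount P (lens k r j) = g.count j := by
  rw [_root_.pointCount_lens h1 h2 hg hj, ← sum_range_getD_eq_count]
  exact Finset.sum_congr rfl fun c hc => hP j hj c hc

theorem HasPattern.getD_lensCol {k : ℕ} {r : ℝ} (h1 : 1 < k * r) (h2 : ((k : ℝ) - 1) * r < 1)
    {g : List ℕ} (hg : 0 < g.length) {P : Finset ℝ} (hP : HasPattern k r g P) {j : ℕ}
    (hj : j ∈ Finset.Icc 1 (k - 1)) {x : ℝ} (hxP : x ∈ P) (hx : x ∈ lens k r j) :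
    g.getD (lensCol k r g.length j x) 0 = j := by
  classical
  have h := hP j hj _ (Finset.mem_range.2 (lensCol_lt h1 h2 hg hj hx))
  by_contra hne
  rw [if_neg hne, pointCount_eq_card_filter, Finset.card_eq_zero,
    Finset.filter_eq_empty_iff] at h
  exact h hxP ⟨hx, rfl⟩

/-! ### Paths in the graph -/

theorem abs_sub_le_length_mul {r : ℝ} {V : Set ℝ} {u v : V} (p : (hardGeometricGraph r V).Walk u v) :
    |(u : ℝ) - v| ≤ p.length * r := by
  induction p with
  | nil => simp
  | cons h p ih =>
    have := abs_sub_le _ _ _ |>.trans (add_le_add h.2.le ih)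
    rw [SimpleGraph.Walk.length_cons]
    push_cast
    linarith

/-- A walk with `k` edges from `0` to `1` is a path, since `k - 1` edges do not suffice. -/
theorem isPath_of_length_eq {k : ℕ} {r : ℝ} (hr : 0 ≤ r) (h2 : ((k : ℝ) - 1) * r < 1)
    {P : Finset ℝ}
    (p : (hardGeometricGraph r (rggVertices P)).Walk (rggLeft P) (rggRight P))
    (hp : p.length = k) : p.IsPath := by
  classical
  have h := abs_sub_le_length_mul p.bypass
  have hk : p.length ≤ p.bypass.length := by
    by_contra! hlt
    have h' : (p.bypass.length : ℝ) + 1 ≤ k := by exact_mod_cast hp ▸ hlt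
    have : |((rggLeft P : rggVertices P) : ℝ) - rggRight P| = 1 := by simp [rggLeft, rggRight]
    nlinarith
  rw [← SimpleGraph.Walk.bypass_eq_self_of_length_le_length_bypass p hk]
  exact p.bypass_isPath

theorem finite_rggVertices (P : Finset ℝ) : (rggVertices P).Finite :=
  P.finite_toSet.union (by simp)

noncomputable instance (P : Finset ℝ) : Fintype (rggVertices P) := (finite_rggVertices P).fintype

open Classical in
/-- The number of walks with `n` edges from the vertex `0` to the vertex `x`. -/
noncomputable def walkCount (r : ℝ) (P : Finset ℝ) (n : ℕ) (x : rggVertices P) : ℕ :=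
  ((hardGeometricGraph r (rggVertices P)).adjMatrix ℕ ^ n) (rggLeft P) x

theorem hopPathCount_eq_walkCount {k : ℕ} {r : ℝ} (hr : 0 ≤ r) (h2 : ((k : ℝ) - 1) * r < 1)
    (P : Finset ℝ) : hopPathCount r k P = walkCount r P k (rggRight P) := by
  classical
  rw [walkCount, SimpleGraph.adjMatrix_pow_apply_eq_card_walk, hopPathCount, Nat.cast_id,
    ← Nat.card_eq_fintype_card]
  exact Nat.card_congr (Equiv.subtypeEquivRight fun p =>
    ⟨fun h => h.2, fun h => ⟨isPath_of_length_eq hr h2 p h, h⟩⟩)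

open Classical in
theorem walkCount_succ (r : ℝ) (P : Finset ℝ) (n : ℕ) (x : rggVertices P) :
    walkCount r P (n + 1) x = ∑ y : rggVertices P,
      if (hardGeometricGraph r (rggVertices P)).Adj y x then walkCount r P n y else 0 := by
  rw [walkCount, pow_succ, Matrix.mul_apply]
  refine Finset.sum_congr rfl fun y _ => ?_
  rw [SimpleGraph.adjMatrix_apply]
  split_ifs <;> simp [walkCount]

open Classical in
theorem walkCount_zero (r : ℝ) (P : Finset ℝ) (x : rggVertices P) :
    walkCount r P 0 x = if rggLeft P = x then 1 else 0 := by
  rw [walkCount, pow_zero, Matrix.one_apply]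

theorem abs_lt_of_walkCount_ne_zero {r : ℝ} {P : Finset ℝ} {n : ℕ} {x : rggVertices P}
    (h : walkCount r P (n + 1) x ≠ 0) : |(x : ℝ)| < (n + 1 : ℕ) * r := by
  classical
  induction n generalizing x with
  | zero =>
    rw [walkCount_succ] at h
    obtain ⟨y, -, hy⟩ := Finset.exists_ne_zero_of_sum_ne_zero h
    rw [walkCount_zero, ← ite_and] at hy
    obtain ⟨hadj, rfl⟩ : _ ∧ _ := by by_contra hc; exact hy (if_neg hc)
    simpa [rggLeft] using hadj.2
  | succ n ih =>
    rw [walkCount_succ] at h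
    obtain ⟨y, -, hy⟩ := Finset.exists_ne_zero_of_sum_ne_zero h
    have hadj : (hardGeometricGraph r (rggVertices P)).Adj y x := by
      by_contra hc; exact hy (if_neg hc)
    rw [if_pos hadj] at hy
    have h3 := abs_sub_abs_le_abs_sub (x : ℝ) y
    have h4 := hadj.symm.2
    have h5 := ih hy
    push_cast at h5 ⊢
    linarith

open Classical in
theorem sum_rggVertices_lens {k : ℕ} {r : ℝ} (h1 : 1 < k * r) (h2 : ((k : ℝ) - 1) * r < 1) {j : ℕ}
    (hj : j ∈ Finset.Icc 1 (k - 1)) (P : Finset ℝ) (F : ℝ → ℕ) :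
    (∑ y : rggVertices P, if (y : ℝ) ∈ lens k r j then F y else 0) =
      ∑ y ∈ P with y ∈ lens k r j, F y := by
  have hsub := lens_subset_Ioo h1 h2 hj
  have h := Finset.sum_subtype (p := (· ∈ rggVertices P)) (F := inferInstance)
    (P ∪ {0, 1}) (fun x => by simp [rggVertices]) fun y => if y ∈ lens k r j then F y else 0
  refine Eq.trans (Eq.trans ?_ h.symm) ?_
  · rfl
  · rw [← Finset.sum_filter]
    congr 1
    ext y
    simp only [Finset.mem_filter, Finset.mem_union, Finset.mem_insert, Finset.mem_singleton]
    constructor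
    · rintro ⟨hy | rfl | rfl, hy'⟩
      · exact ⟨hy, hy'⟩
      · exact absurd (hsub hy').1 (lt_irrefl _)
      · exact absurd (hsub hy').2 (lt_irrefl _)
    · exact fun h => ⟨Or.inl h.1, h.2⟩

theorem mem_of_mem_lens {k : ℕ} {r : ℝ} (h1 : 1 < k * r) (h2 : ((k : ℝ) - 1) * r < 1) {j : ℕ}
    (hj : j ∈ Finset.Icc 1 (k - 1)) {P : Finset ℝ} {x : ℝ} (hx : x ∈ rggVertices P)
    (hxj : x ∈ lens k r j) : x ∈ P := by
  have hsub := lens_subset_Ioo h1 h2 hj hxj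
  rcases hx with hx | rfl | rfl
  · exact hx
  · exact absurd hsub.1 (lt_irrefl _)
  · exact absurd hsub.2 (lt_irrefl _)

/-- A point `y` of the `j`-th lens and a point `x` of the next one are joined exactly when the column
of `y` comes before the column of `x`: with `y = j * r - s` and `x = (j + 1) * r - t`, the distance is
`r - (t - s)`, and the two columns differ because a column has at most one point. -/
theorem HasPattern.abs_sub_lt_iff {k : ℕ} {r : ℝ} (h1 : 1 < k * r) (h2 : ((k : ℝ) - 1) * r < 1)
    {g : List ℕ} (hg : 0 < g.length) {P : Finset ℝ} (hP : HasPattern k r g P) {j : ℕ}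
    (hj : j ∈ Finset.Icc 1 (k - 1)) (hj' : j + 1 ∈ Finset.Icc 1 (k - 1)) {x y : ℝ} (hxP : x ∈ P)
    (hyP : y ∈ P) (hy : y ∈ lens k r j) (hx : x ∈ lens k r (j + 1)) :
    (y ≠ x ∧ |y - x| < r) ↔ lensCol k r g.length j y < lensCol k r g.length (j + 1) x := by
  have hne : lensCol k r g.length j y ≠ lensCol k r g.length (j + 1) x := by
    intro h
    have e1 := hP.getD_lensCol h1 h2 hg hj hyP hy
    have e2 := hP.getD_lensCol h1 h2 hg hj' hxP hx
    rw [h, e2] at e1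
    omega
  have hyx : y ≠ x := by
    rintro rfl
    exact Set.disjoint_left.1 (disjoint_lens h1 h2 hj hj' (by omega)) hy hx
  have hl : 0 < k * r - 1 := by linarith
  have hN : (0 : ℝ) < g.length := by exact_mod_cast hg
  have hlt : y < x := by
    rw [lens_eq_Ioo h1 h2 hj] at hy
    rw [lens_eq_Ioo h1 h2 hj'] at hx
    have hy2 := hy.2
    have hx1 := hx.1
    push_cast at hx1
    linarith
  have hmono : ∀ {s t : ℝ}, s ≤ t → s * g.length / (k * r - 1) ≤ t * g.length / (k * r - 1) :=
    fun h => by gcongr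
  rw [and_iff_right hyx, abs_sub_comm, abs_of_pos (sub_pos.2 hlt)]
  constructor
  · intro h
    refine lt_of_le_of_ne (Nat.floor_mono (hmono ?_)) hne
    push_cast
    linarith
  · intro h
    by_contra! hc
    refine absurd (Nat.floor_mono (hmono ?_)) (not_le.2 h)
    push_cast
    linarith

/-- The walks with `j` edges from `0` to a point of the `j`-th lens are the chains of the word that
end there. -/
theorem HasPattern.walkCount_eq {k : ℕ} {r : ℝ} (h1 : 1 < k * r) (h2 : ((k : ℝ) - 1) * r < 1)
    {g : List ℕ} (hg : 0 < g.length) {P : Finset ℝ} (hP : HasPattern k r g P) {j : ℕ}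
    (hj : j + 1 ∈ Finset.Icc 1 (k - 1)) (x : rggVertices P) (hx : (x : ℝ) ∈ lens k r (j + 1)) :
    walkCount r P (j + 1) x = chainCount j (g.take (lensCol k r g.length (j + 1) x)) := by
  classical
  induction j generalizing x with
  | zero =>
    have hx0 : 0 < (x : ℝ) := (lens_subset_Ioo h1 h2 hj hx).1
    have hxr : (x : ℝ) < r := by
      rw [lens_eq_Ioo h1 h2 hj] at hx
      simpa using hx.2
    have hadj : (hardGeometricGraph r (rggVertices P)).Adj (rggLeft P) x := by
      refine ⟨fun h => hx0.ne (congrArg Subtype.val h), ?_⟩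
      simpa [rggLeft, abs_of_pos hx0] using hxr
    rw [walkCount_succ, Finset.sum_eq_single (rggLeft P)]
    · rw [if_pos hadj, walkCount_zero, if_pos rfl, chainCount]
    · intro y _ hy
      rw [walkCount_zero, if_neg (Ne.symm hy), ite_self]
    · simp
  | succ j ih =>
    have hj' : j + 1 ∈ Finset.Icc 1 (k - 1) := by simp at hj ⊢; omega
    have hxP := mem_of_mem_lens h1 h2 hj x.2 hx
    -- The last vertex `y` before `x` is within `(j + 1) * r` of `0` and, being joined to `x`, within
    -- `(k - (j + 1)) * r` of `1`; so it is in the previous lens.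
    have hterm : ∀ y : rggVertices P,
        (if (hardGeometricGraph r (rggVertices P)).Adj y x then walkCount r P (j + 1) y else 0) =
          if (y : ℝ) ∈ lens k r (j + 1) then
            (if lensCol k r g.length (j + 1) y < lensCol k r g.length (j + 1 + 1) x then
              chainCount j (g.take (lensCol k r g.length (j + 1) y)) else 0) else 0 := by
      intro y
      by_cases hy : (y : ℝ) ∈ lens k r (j + 1)
      · have hadj : (hardGeometricGraph r (rggVertices P)).Adj y x ↔
            lensCol k r g.length (j + 1) y < lensCol k r g.length (j + 1 + 1) x := by
          rw [← hP.abs_sub_lt_iff h1 h2 hg hj' hj hxP (mem_of_mem_lens h1 h2 hj' y.2 hy) hy hx]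
          simp [hardGeometricGraph, Subtype.ext_iff]
        rw [if_pos hy, ih hj' y hy]
        exact if_congr hadj rfl rfl
      · rw [if_neg hy, ite_eq_right_iff]
        intro hadj
        by_contra hne
        refine hy ⟨?_, ?_⟩
        · simpa using abs_lt_of_walkCount_ne_zero hne
        · have h3 := hx.2
          rw [Metric.mem_ball, Real.dist_eq] at h3 ⊢
          have h4 := abs_sub_le (y : ℝ) x 1
          have h5 := hadj.2
          push_cast at h3 ⊢
          linarith
    rw [walkCount_succ, Finset.sum_congr rfl fun y _ => hterm y,
      sum_rggVertices_lens h1 h2 hj' P fun y =>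
        if lensCol k r g.length (j + 1) y < lensCol k r g.length (j + 1 + 1) x then
              chainCount j (g.take (lensCol k r g.length (j + 1) y)) else 0,
      sum_lens_eq_sum_col h1 h2 hg hj' P fun c =>
        if c < lensCol k r g.length (j + 1 + 1) x then chainCount j (g.take c) else 0,
      chainCount_take j (lensCol_lt h1 h2 hg hj hx).le,
      ← Finset.sum_subset (Finset.range_subset_range.2 (lensCol_lt h1 h2 hg hj hx).le)]
    · refine Finset.sum_congr rfl fun c hc => ?_
      rw [hP (j + 1) hj' c (Finset.mem_range.2 ((Finset.mem_range.1 hc).trans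
        (lensCol_lt h1 h2 hg hj hx))), if_pos (Finset.mem_range.1 hc)]
      simp
    · intro c _ hc
      rw [if_neg fun h => hc (Finset.mem_range.2 h), mul_zero]

theorem HasPattern.hopPathCount_eq {k : ℕ} {r : ℝ} (h1 : 1 < ((k + 2 : ℕ) : ℝ) * r)
    (h2 : (((k + 2 : ℕ) : ℝ) - 1) * r < 1) {g : List ℕ} (hg : 0 < g.length) {P : Finset ℝ}
    (hP : HasPattern (k + 2) r g P) : hopPathCount r (k + 2) P = chainCount (k + 1) g := by
  classical
  have hk : k + 1 ∈ Finset.Icc 1 (k + 2 - 1) := by simp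
  have hr : 0 ≤ r := by push_cast at h1 h2; nlinarith
  have hterm : ∀ y : rggVertices P,
      (if (hardGeometricGraph r (rggVertices P)).Adj y (rggRight P) then
        walkCount r P (k + 1) y else 0) =
        if (y : ℝ) ∈ lens (k + 2) r (k + 1) then
          chainCount k (g.take (lensCol (k + 2) r g.length (k + 1) y)) else 0 := by
    intro y
    have hy : ((hardGeometricGraph r (rggVertices P)).Adj y (rggRight P)) ↔
        (y : ℝ) ≠ 1 ∧ |(y : ℝ) - 1| < r := by
      simp [hardGeometricGraph, rggRight, Subtype.ext_iff]
    by_cases hyl : (y : ℝ) ∈ lens (k + 2) r (k + 1)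
    · have hy1 := (lens_subset_Ioo h1 h2 hk hyl).2.ne
      have hyr : |(y : ℝ) - 1| < r := by
        have := hyl.2
        rw [Metric.mem_ball, Real.dist_eq] at this
        push_cast at this
        linarith
      rw [if_pos hyl, if_pos (hy.2 ⟨hy1, hyr⟩), hP.walkCount_eq h1 h2 hg hk y hyl]
    · rw [if_neg hyl, ite_eq_right_iff]
      intro hadj
      by_contra hne
      refine hyl ⟨?_, ?_⟩
      · simpa using abs_lt_of_walkCount_ne_zero hne
      · rw [Metric.mem_ball, Real.dist_eq]
        have := (hy.1 hadj).2
        push_cast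
        linarith
  rw [hopPathCount_eq_walkCount hr h2, walkCount_succ, Finset.sum_congr rfl fun y _ => hterm y,
    sum_rggVertices_lens h1 h2 hk P fun y =>
      chainCount k (g.take (lensCol (k + 2) r g.length (k + 1) y)),
    sum_lens_eq_sum_col h1 h2 hg hk P fun c => chainCount k (g.take c), chainCount]
  refine Finset.sum_congr rfl fun c hc => ?_
  rw [hP (k + 1) hk c hc]
  simp

/-! ### Poisson counts of cells -/

open MeasureTheory ProbabilityTheory Filter Topology

theorem measure_forall_pointCount_eq {Ω : Type*} [MeasurableSpace Ω] {μ : Measure Ω}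
    {lam : NNReal} {X : Ω → Finset ℝ} (hX : IsPoissonProcess μ lam X) {ι : Type*} (s : Finset ι)
    (B : ι → Set ℝ) (hB : ∀ i ∈ s, MeasurableSet (B i)) (hsub : ∀ i ∈ s, B i ⊆ Set.Icc 0 1)
    (hdisj : (s : Set ι).PairwiseDisjoint B) (n : ι → ℕ) :
    μ {ω | ∀ i ∈ s, pointCount (X ω) (B i) = n i} =
      ∏ i ∈ s, poissonMeasure (lam * (volume (B i)).toNNReal) {n i} := by
  let e : Fin s.card ≃ s := s.equivFin.symm
  have hind := hX.indep_count s.card (fun i => B (e i)) (fun i => hB _ (e i).2)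
    (fun i => hsub _ (e i).2) fun i j hij =>
      hdisj (e i).2 (e j).2 fun h => hij (e.injective (Subtype.ext h))
  have h := hind.measure_inter_preimage_eq_mul Finset.univ (sets := fun i => {n (e i)})
    fun i _ => measurableSet_singleton _
  have hset : {ω | ∀ i ∈ s, pointCount (X ω) (B i) = n i} =
      ⋂ i ∈ (Finset.univ : Finset (Fin s.card)),
        (fun ω => pointCount (X ω) (B (e i))) ⁻¹' {n (e i)} := by
    ext ω
    simp only [Set.mem_ofPred_eq, Set.mem_iInter, Finset.mem_univ, forall_true_left,
      Set.mem_preimage, Set.mem_singleton_iff]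
    refine ⟨fun h i => h _ (e i).2, fun h i hi => ?_⟩
    simpa using h (e.symm ⟨i, hi⟩)
  rw [hset, h, ← Finset.prod_coe_sort s, ← e.prod_comp]
  refine Finset.prod_congr rfl fun i _ => ?_
  rw [← hX.map_count _ (hB _ (e i).2) (hsub _ (e i).2),
    Measure.map_apply (hX.measurable_count _ (hB _ (e i).2) (hsub _ (e i).2))
      (measurableSet_singleton _)]

/-- Since `exp (-x) ≥ 1 - x`, the probability is at most `1 - (1 - x) * (1 + x)`. -/
theorem poissonMeasure_real_Ici_two_le (x : NNReal) :
    (poissonMeasure x).real (Set.Ici 2) ≤ (x : ℝ) ^ 2 := by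
  have hs : (Set.Ici 2 : Set ℕ) = (({0} : Set ℕ) ∪ {1})ᶜ := by
    ext n
    simp only [Set.mem_Ici, Set.mem_compl_iff, Set.mem_union, Set.mem_singleton_iff]
    omega
  rw [hs, probReal_compl_eq_one_sub .of_discrete, measureReal_union (by simp) .of_discrete,
    poissonMeasure_real_singleton, poissonMeasure_real_singleton]
  have h := Real.add_one_le_exp (-(x : ℝ))
  simp
  nlinarith [x.2]

theorem measureReal_two_le_pointCount_le {Ω : Type*} [MeasurableSpace Ω] {μ : Measure Ω}
    {lam : NNReal} {X : Ω → Finset ℝ} (hX : IsPoissonProcess μ lam X)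
    {B : Set ℝ} (hB : MeasurableSet B) (hsub : B ⊆ Set.Icc 0 1) :
    μ.real {ω | 2 ≤ pointCount (X ω) B} ≤ (lam * volume.real B) ^ 2 := by
  have h := poissonMeasure_real_Ici_two_le (lam * (volume B).toNNReal)
  rw [← hX.map_count B hB hsub,
    map_measureReal_apply (hX.measurable_count B hB hsub) .of_discrete] at h
  exact h

theorem measurableSet_lens (k : ℕ) (r : ℝ) (j : ℕ) : MeasurableSet (lens k r j) :=
  Metric.isOpen_ball.measurableSet.inter Metric.isOpen_ball.measurableSet

theorem measurableSet_cell (k : ℕ) (r : ℝ) (N j c : ℕ) : MeasurableSet (cell k r N j c) := by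
  have h : Measurable (lensCol k r N j) := Nat.measurable_floor.comp (by fun_prop)
  exact (measurableSet_lens k r j).inter (h (measurableSet_singleton c))

theorem cell_subset_Icc {k : ℕ} {r : ℝ} (h1 : 1 < k * r) (h2 : ((k : ℝ) - 1) * r < 1) {N j c : ℕ}
    (hj : j ∈ Finset.Icc 1 (k - 1)) : cell k r N j c ⊆ Set.Icc 0 1 := fun _ hx =>
  Set.Ioo_subset_Icc_self (lens_subset_Ioo h1 h2 hj hx.1)

theorem disjoint_cell {k : ℕ} {r : ℝ} (h1 : 1 < k * r) (h2 : ((k : ℝ) - 1) * r < 1)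
    {N i j c d : ℕ} (hi : i ∈ Finset.Icc 1 (k - 1)) (hj : j ∈ Finset.Icc 1 (k - 1))
    (h : (i, c) ≠ (j, d)) : Disjoint (cell k r N i c) (cell k r N j d) := by
  by_cases hij : i = j
  · subst hij
    rw [Set.disjoint_left]
    rintro x ⟨_, rfl⟩ ⟨_, rfl⟩
    exact h rfl
  · exact (disjoint_lens h1 h2 hi hj hij).mono (fun _ hx => hx.1) fun _ hx => hx.1

theorem volume_lens {k : ℕ} {r : ℝ} (h1 : 1 < k * r) (h2 : ((k : ℝ) - 1) * r < 1) {j : ℕ}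
    (hj : j ∈ Finset.Icc 1 (k - 1)) : volume (lens k r j) = ENNReal.ofReal (k * r - 1) := by
  rw [lens_eq_Ioo h1 h2 hj, Real.volume_Ioo]
  congr 1
  ring

theorem volume_cell {k : ℕ} {r : ℝ} (h1 : 1 < k * r) (h2 : ((k : ℝ) - 1) * r < 1) {N j c : ℕ}
    (hj : j ∈ Finset.Icc 1 (k - 1)) (hc : c < N) :
    volume (cell k r N j c) = ENNReal.ofReal ((k * r - 1) / N) := by
  have hN : (0 : ℝ) < N := by exact_mod_cast (by omega : 0 < N)
  have hl : 0 < k * r - 1 := by linarith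
  have hlen : (j * r - c * (k * r - 1) / N) - (j * r - (c + 1) * (k * r - 1) / N) =
      (k * r - 1) / N := by ring
  have hc' : (c : ℝ) + 1 ≤ N := by exact_mod_cast hc
  refine le_antisymm ?_ ?_
  · rw [← hlen, ← Real.volume_Icc]
    refine measure_mono fun x hx => ?_
    obtain ⟨hx, hxc⟩ := hx
    rw [lens_eq_Ioo h1 h2 hj] at hx
    rw [lensCol, Nat.floor_eq_iff (div_nonneg (mul_nonneg (by linarith [hx.2]) hN.le) hl.le),
      le_div_iff₀ hl, div_lt_iff₀ hl] at hxc
    constructor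
    · rw [sub_le_comm, le_div_iff₀ hN]; exact hxc.2.le
    · rw [le_sub_comm, div_le_iff₀ hN]; exact hxc.1
  · rw [← hlen, ← Real.volume_Ioo]
    refine measure_mono fun x hx => ?_
    obtain ⟨hx1, hx2⟩ := hx
    rw [sub_lt_comm, lt_div_iff₀ hN] at hx1
    rw [lt_sub_comm, div_lt_iff₀ hN] at hx2
    have hs : 0 < j * r - x := by
      have : 0 ≤ c * (k * r - 1) := by positivity
      nlinarith
    refine ⟨?_, ?_⟩
    · rw [lens_eq_Ioo h1 h2 hj]
      constructor <;> nlinarith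
    · rw [lensCol, Nat.floor_eq_iff (by positivity), le_div_iff₀ hl, div_lt_iff₀ hl]
      exact ⟨hx2.le, hx1⟩

/-! ### Columns with at most one point -/

/-- Every one of the `N` columns has at most one point of `P`, all lenses together. -/
def SparseColumns (k : ℕ) (r : ℝ) (N : ℕ) (P : Finset ℝ) : Prop :=
  ∀ c ∈ Finset.range N, ∑ j ∈ Finset.Icc 1 (k - 1), pointCount P (cell k r N j c) ≤ 1

theorem pointCount_biUnion (P : Finset ℝ) {ι : Type*} (s : Finset ι) (B : ι → Set ℝ)
    (hdisj : (s : Set ι).PairwiseDisjoint B) :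
    pointCount P (⋃ i ∈ s, B i) = ∑ i ∈ s, pointCount P (B i) := by
  classical
  simp_rw [pointCount_eq_card_filter]
  rw [← Finset.card_biUnion]
  · congr 1
    ext x
    simp only [Finset.mem_filter, Set.mem_iUnion, Finset.mem_biUnion, exists_prop]
    grind
  · intro i hi j hj hij
    refine Finset.disjoint_filter.2 fun x _ hx hx' => ?_
    exact Set.disjoint_left.1 (hdisj hi hj hij) hx hx'

/-- Two points are in one of `N` columns with probability `O(1 / N)`. -/
theorem measureReal_not_sparseColumns_le {Ω : Type*} [MeasurableSpace Ω] {μ : Measure Ω}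
    [IsProbabilityMeasure μ] {lam : NNReal} {X : Ω → Finset ℝ} (hX : IsPoissonProcess μ lam X)
    {k : ℕ} {r : ℝ} (h1 : 1 < k * r) (h2 : ((k : ℝ) - 1) * r < 1) (N : ℕ) :
    μ.real {ω | SparseColumns k r N (X ω)}ᶜ ≤
      (lam * ((k - 1 : ℕ) * (k * r - 1))) ^ 2 / N := by
  have hl : 0 < k * r - 1 := by linarith
  have hset : {ω | SparseColumns k r N (X ω)}ᶜ = ⋃ c ∈ Finset.range N,
      {ω | 2 ≤ pointCount (X ω) (⋃ j ∈ Finset.Icc 1 (k - 1), cell k r N j c)} := by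
    ext ω
    simp only [SparseColumns, Set.mem_compl_iff, Set.mem_ofPred_eq, Set.mem_iUnion, exists_prop,
      not_forall, not_le]
    refine exists_congr fun c => and_congr_right fun _ => ?_
    rw [pointCount_biUnion _ _ _ fun i hi j hj hij => disjoint_cell h1 h2 hi hj (by simpa using hij)]
    rfl
  rw [hset]
  refine (measureReal_biUnion_finset_le _ _).trans ?_
  have hcol : ∀ c ∈ Finset.range N,
      μ.real {ω | 2 ≤ pointCount (X ω) (⋃ j ∈ Finset.Icc 1 (k - 1), cell k r N j c)} ≤
        (lam * ((k - 1 : ℕ) * ((k * r - 1) / N))) ^ 2 := by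
    intro c hc
    refine (measureReal_two_le_pointCount_le hX
      (Finset.measurableSet_biUnion _ fun j _ => measurableSet_cell k r N j c)
      (Set.iUnion₂_subset fun j hj => cell_subset_Icc h1 h2 hj)).trans ?_
    gcongr
    refine (measureReal_biUnion_finset_le _ _).trans ?_
    rw [Finset.sum_congr rfl fun j hj => by
      rw [measureReal_def, volume_cell h1 h2 hj (Finset.mem_range.1 hc),
        ENNReal.toReal_ofReal (by positivity)]]
    simp
  refine (Finset.sum_le_sum hcol).trans (le_of_eq ?_)
  rcases eq_or_ne N 0 with rfl | hN
  · simp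
  · have : (N : ℝ) ≠ 0 := by exact_mod_cast hN
    rw [Finset.sum_const, Finset.card_range, nsmul_eq_mul]
    field_simp

theorem tendsto_measureReal_inter_sparseColumns {Ω : Type*} [MeasurableSpace Ω] {μ : Measure Ω}
    [IsProbabilityMeasure μ] {lam : NNReal} {X : Ω → Finset ℝ} (hX : IsPoissonProcess μ lam X)
    {k : ℕ} {r : ℝ} (h1 : 1 < k * r) (h2 : ((k : ℝ) - 1) * r < 1) (Y : Set Ω) :
    Tendsto (fun N : ℕ => μ.real (Y ∩ {ω | SparseColumns k r N (X ω)})) atTop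
      (𝓝 (μ.real Y)) := by
  have hlim : Tendsto (fun N : ℕ => μ.real Y - (lam * ((k - 1 : ℕ) * (k * r - 1))) ^ 2 / (N : ℝ))
      atTop (𝓝 (μ.real Y)) := by
    simpa using tendsto_const_nhds.sub
      (tendsto_const_div_atTop_nhds_zero_nat ((lam * ((k - 1 : ℕ) * (k * r - 1)) : ℝ) ^ 2))
  refine tendsto_of_tendsto_of_tendsto_of_le_of_le hlim tendsto_const_nhds (fun N => ?_)
    fun N => measureReal_mono Set.inter_subset_left
  have h3 := measureReal_not_sparseColumns_le hX h1 h2 N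
  have h4 : μ.real Y ≤ μ.real (Y ∩ {ω | SparseColumns k r N (X ω)}) +
      μ.real {ω | SparseColumns k r N (X ω)}ᶜ := by
    refine le_trans (measureReal_mono fun ω hω => ?_) (measureReal_union_le _ _)
    by_cases h : SparseColumns k r N (X ω)
    · exact Or.inl ⟨hω, h⟩
    · exact Or.inr h
  dsimp only
  linarith

/-! ### The probability of a pattern -/

theorem exists_eq_ite_of_sum_le_one {I : Finset ℕ} (hI : 0 ∉ I) (a : ℕ → ℕ)
    (ha : ∑ j ∈ I, a j ≤ 1) : ∃ l ∈ insert 0 I, ∀ j ∈ I, a j = if l = j then 1 else 0 := by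
  by_cases h : ∀ j ∈ I, a j = 0
  · refine ⟨0, Finset.mem_insert_self _ _, fun j hj => ?_⟩
    rw [h j hj, if_neg]
    rintro rfl
    exact hI hj
  · push Not at h
    obtain ⟨l, hl, hal⟩ := h
    refine ⟨l, Finset.mem_insert_of_mem hl, fun j hj => ?_⟩
    rw [← Finset.add_sum_erase _ _ hl] at ha
    split_ifs with hlj
    · subst hlj; omega
    · have := Finset.single_le_sum (f := a) (fun _ _ => Nat.zero_le _)
        (Finset.mem_erase.2 ⟨Ne.symm hlj, hj⟩)
      omega

theorem sparseColumns_iff_exists_hasPattern {k : ℕ} {r : ℝ} {N : ℕ} {P : Finset ℝ} :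
    SparseColumns k r N P ↔ ∃ g : List ℕ, g.length = N ∧
      (∀ i ∈ g, i ∈ insert 0 (Finset.Icc 1 (k - 1))) ∧ HasPattern k r g P := by
  constructor
  · intro h
    have h' : ∀ c, ∃ l ∈ insert 0 (Finset.Icc 1 (k - 1)), c ∈ Finset.range N →
        ∀ j ∈ Finset.Icc 1 (k - 1), pointCount P (cell k r N j c) = if l = j then 1 else 0 := by
      intro c
      by_cases hc : c ∈ Finset.range N
      · obtain ⟨l, hl, hl'⟩ := exists_eq_ite_of_sum_le_one (by simp) _ (h c hc)
        exact ⟨l, hl, fun _ => hl'⟩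
      · exact ⟨0, Finset.mem_insert_self _ _, fun h => absurd h hc⟩
    choose f hf hf' using h'
    refine ⟨(List.range N).map f, by simp, fun i hi => ?_, fun j hj c hc => ?_⟩
    · obtain ⟨c, -, rfl⟩ := List.mem_map.1 hi
      exact hf c
    · rw [List.length_map, List.length_range] at hc ⊢
      rw [hf' c hc j hj]
      have : ((List.range N).map f).getD c 0 = f c := by
        simp [List.getD_eq_getElem?_getD, Finset.mem_range.1 hc]
      rw [this]
  · rintro ⟨g, rfl, -, hg⟩ c hc
    rw [Finset.sum_congr rfl fun j hj => hg j hj c hc, Finset.sum_ite_eq]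
    split_ifs <;> simp

theorem HasPattern.unique {k : ℕ} {r : ℝ} {P : Finset ℝ} {g h : List ℕ} (hlen : g.length = h.length)
    (hgI : ∀ i ∈ g, i ∈ insert 0 (Finset.Icc 1 (k - 1)))
    (hhI : ∀ i ∈ h, i ∈ insert 0 (Finset.Icc 1 (k - 1)))
    (hg : HasPattern k r g P) (hh : HasPattern k r h P) : g = h := by
  refine List.ext_getElem hlen fun c hc hc' => ?_
  have hgD : g.getD c 0 = g[c] := by simp [hc]
  have hhD : h.getD c 0 = h[c] := by simp [hc']
  have key : ∀ j ∈ Finset.Icc 1 (k - 1), (g[c] = j ↔ h[c] = j) := by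
    intro j hj
    have e1 := hg j hj c (Finset.mem_range.2 hc)
    have e2 := hh j hj c (Finset.mem_range.2 hc')
    rw [hlen, e2, hgD, hhD] at e1
    grind
  rcases Finset.mem_insert.1 (hgI _ (List.getElem_mem hc)) with h0 | h0
  · rcases Finset.mem_insert.1 (hhI _ (List.getElem_mem hc')) with h0' | h0'
    · rw [h0, h0']
    · exact (key _ h0').2 rfl
  · exact ((key _ h0).1 rfl).symm

theorem setOf_hasPattern (k : ℕ) (r : ℝ) (g : List ℕ) {Ω : Type*} (X : Ω → Finset ℝ) :
    {ω | HasPattern k r g (X ω)} =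
      {ω | ∀ p ∈ Finset.Icc 1 (k - 1) ×ˢ Finset.range g.length,
        pointCount (X ω) (cell k r g.length p.1 p.2) = if g.getD p.2 0 = p.1 then 1 else 0} := by
  ext ω
  simp only [HasPattern, Set.mem_ofPred_eq, Prod.forall, Finset.mem_product]
  exact ⟨fun h j c hjc => h j hjc.1 c hjc.2, fun h j hj c hc => h j c ⟨hj, hc⟩⟩

/-- The probability of a pattern depends only on its length and on its letter counts. -/
theorem measure_hasPattern {Ω : Type*} [MeasurableSpace Ω] {μ : Measure Ω}
    {lam : NNReal} {X : Ω → Finset ℝ} (hX : IsPoissonProcess μ lam X)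
    {k : ℕ} {r : ℝ} (h1 : 1 < k * r) (h2 : ((k : ℝ) - 1) * r < 1) (g : List ℕ) :
    μ {ω | HasPattern k r g (X ω)} = ∏ j ∈ Finset.Icc 1 (k - 1),
      (poissonMeasure (lam * ((k * r - 1) / g.length).toNNReal) {1} ^ g.count j *
        poissonMeasure (lam * ((k * r - 1) / g.length).toNNReal) {0} ^
          (g.length - g.count j)) := by
  rw [setOf_hasPattern, measure_forall_pointCount_eq hX _
    (fun p : ℕ × ℕ => cell k r g.length p.1 p.2) (fun p _ => measurableSet_cell _ _ _ _ _)
    (fun p hp => cell_subset_Icc h1 h2 (Finset.mem_product.1 hp).1)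
    (fun p hp q hq hpq => disjoint_cell h1 h2 (Finset.mem_product.1 hp).1
      (Finset.mem_product.1 hq).1 hpq) (fun p => if g.getD p.2 0 = p.1 then 1 else 0),
    Finset.prod_product]
  refine Finset.prod_congr rfl fun j hj => ?_
  have hcard : ((Finset.range g.length).filter fun c => g.getD c 0 = j).card = g.count j := by
    rw [Finset.card_filter, sum_range_getD_eq_count]
  have hcard' : ((Finset.range g.length).filter fun c => ¬ g.getD c 0 = j).card =
      g.length - g.count j := by
    have := Finset.card_filter_add_card_filter_not (s := Finset.range g.length)
      fun c => g.getD c 0 = j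
    rw [hcard, Finset.card_range] at this
    omega
  rw [← hcard', ← hcard, ← Finset.prod_const, ← Finset.prod_const, ← Finset.prod_ite]
  refine Finset.prod_congr rfl fun c hc => ?_
  dsimp only
  rw [volume_cell h1 h2 hj (Finset.mem_range.1 hc), ENNReal.ofReal, ENNReal.toNNReal_coe]
  split_ifs <;> rfl

theorem measurableSet_hasPattern {Ω : Type*} [MeasurableSpace Ω] {μ : Measure Ω}
    {lam : NNReal} {X : Ω → Finset ℝ} (hX : IsPoissonProcess μ lam X)
    {k : ℕ} {r : ℝ} (h1 : 1 < k * r) (h2 : ((k : ℝ) - 1) * r < 1) (g : List ℕ) :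
    MeasurableSet {ω | HasPattern k r g (X ω)} := by
  rw [setOf_hasPattern]
  have : {ω | ∀ p ∈ Finset.Icc 1 (k - 1) ×ˢ Finset.range g.length,
        pointCount (X ω) (cell k r g.length p.1 p.2) = if g.getD p.2 0 = p.1 then 1 else 0} =
      ⋂ p ∈ Finset.Icc 1 (k - 1) ×ˢ Finset.range g.length,
        (fun ω => pointCount (X ω) (cell k r g.length p.1 p.2)) ⁻¹'
          {if g.getD p.2 0 = p.1 then 1 else 0} := by
    ext ω; simp
  rw [this]
  exact Finset.measurableSet_biInter _ fun p hp =>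
    hX.measurable_count _ (measurableSet_cell _ _ _ _ _)
      (cell_subset_Icc h1 h2 (Finset.mem_product.1 hp).1) (measurableSet_singleton _)

/-! ### The law of the number of paths -/

theorem HasPattern.mem_lensEvent_iff {Ω : Type*} {X : Ω → Finset ℝ} {k : ℕ} {r : ℝ}
    (h1 : 1 < k * r) (h2 : ((k : ℝ) - 1) * r < 1) {g : List ℕ} (hg : 0 < g.length)
    (hgI : ∀ i ∈ g, i ∈ insert 0 (Finset.Icc 1 (k - 1))) {ω : Ω} (hP : HasPattern k r g (X ω))
    (m : ℕ → ℕ) :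
    ω ∈ lensEvent X k r m ↔ g.filter (· ≠ 0) ∈ latticePaths (Finset.Icc 1 (k - 1)) m := by
  have hcount : ∀ j ∈ Finset.Icc 1 (k - 1), (g.filter (· ≠ 0)).count j =
      pointCount (X ω) (lens k r j) := by
    intro j hj
    rw [hP.pointCount_lens h1 h2 hg hj, List.count_filter]
    exact decide_eq_true (by have := (Finset.mem_Icc.1 hj).1; omega)
  rw [mem_latticePaths, lensEvent, Set.mem_ofPred_eq]
  constructor
  · refine fun h => ⟨fun i hi => ?_, fun j hj => by rw [hcount j hj, h j hj]⟩
    obtain ⟨hi, hi0⟩ := List.mem_filter.1 hi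
    exact (Finset.mem_insert.1 (hgI i hi)).resolve_left (of_decide_eq_true hi0)
  · exact fun h j hj => by rw [← hcount j hj, h.2 j hj]

/-- On the event that no column has two points, the words of the configurations with the given lens
counts all carry the same weight `q`. -/
theorem exists_measure_inter_sparseColumns {Ω : Type*} [MeasurableSpace Ω] {μ : Measure Ω}
    {lam : NNReal} {X : Ω → Finset ℝ} (hX : IsPoissonProcess μ lam X)
    {k : ℕ} {r : ℝ} (h1 : 1 < ((k + 2 : ℕ) : ℝ) * r)
    (h2 : (((k + 2 : ℕ) : ℝ) - 1) * r < 1) (m : ℕ → ℕ) {N : ℕ}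
    (hN : ∑ j ∈ Finset.Icc 1 (k + 1), m j < N) :
    ∃ q : ENNReal, ∀ (Q : ℕ → Prop) [DecidablePred Q],
      μ (lensEvent X (k + 2) r m ∩ {ω | Q (hopPathCount r (k + 2) (X ω))} ∩
          {ω | SparseColumns (k + 2) r N (X ω)}) =
        ((latticePaths (Finset.Icc 1 (k + 1)) m).filter fun W => Q (chainCount (k + 1) W)).card *
          q := by
  classical
  set I := Finset.Icc 1 (k + 1) with hI
  have h0I : 0 ∉ I := by simp [hI]
  -- The letter `0` stands for an empty column.
  set m' := Function.update m 0 (N - ∑ j ∈ I, m j) with hm'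
  have hm'I : ∀ j ∈ I, m' j = m j := fun j hj =>
    Function.update_of_ne (by rintro rfl; exact h0I hj) _ _
  have hsum : ∑ j ∈ I, m' j = ∑ j ∈ I, m j := Finset.sum_congr rfl hm'I
  have hm'0 : m' 0 = N - ∑ j ∈ I, m j := Function.update_self ..
  have hpaths : latticePaths I m = latticePaths I m' := by
    ext w
    simp only [mem_latticePaths]
    exact and_congr_right fun _ => forall₂_congr fun j hj => by rw [hm'I j hj]
  have hlen : ∀ g ∈ latticePaths (insert 0 I) m', g.length = N := by
    intro g hg
    rw [length_of_mem_latticePaths hg, Finset.sum_insert h0I, hsum, hm'0]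
    omega
  set φ := fun n : ℕ =>
    poissonMeasure (lam * ((((k + 2 : ℕ) : ℝ) * r - 1) / N).toNNReal) {n} with hφ
  refine ⟨(m' 0 + ∑ j ∈ I, m' j).choose (m' 0) * ∏ j ∈ I, (φ 1 ^ m j * φ 0 ^ (N - m j)),
    fun Q _ => ?_⟩
  set S := (latticePaths I m).filter fun W => Q (chainCount (k + 1) W) with hS
  have hSsub : S ⊆ latticePaths I m' := hpaths ▸ Finset.filter_subset _ _
  set T := (latticePaths (insert 0 I) m').filter fun g => g.filter (· ≠ 0) ∈ S with hT
  have hchain : ∀ g : List ℕ, chainCount (k + 1) (g.filter (· ≠ 0)) = chainCount (k + 1) g :=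
    fun g => chainCount_filter _ _ _ fun i hi _ => decide_eq_true (by omega)
  have hset : lensEvent X (k + 2) r m ∩ {ω | Q (hopPathCount r (k + 2) (X ω))} ∩
      {ω | SparseColumns (k + 2) r N (X ω)} = ⋃ g ∈ T, {ω | HasPattern (k + 2) r g (X ω)} := by
    ext ω
    simp only [Set.mem_inter_iff, Set.mem_ofPred_eq, Set.mem_iUnion, exists_prop,
      sparseColumns_iff_exists_hasPattern]
    constructor
    · rintro ⟨⟨hA, hQ⟩, g, hgN, hgI, hg⟩
      have hg0 : 0 < g.length := by omega
      have hgm := (hg.mem_lensEvent_iff h1 h2 hg0 hgI m).1 hA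
      rw [hg.hopPathCount_eq h1 h2 hg0] at hQ
      refine ⟨g, Finset.mem_filter.2 ⟨mem_latticePaths.2 ⟨hgI, ?_⟩,
        Finset.mem_filter.2 ⟨hgm, by rwa [hchain]⟩⟩, hg⟩
      have hgI' : ∀ j ∈ I, g.count j = m' j := by
        intro j hj
        rw [hm'I j hj, ← (mem_latticePaths.1 hgm).2 j hj, List.count_filter]
        exact decide_eq_true (ne_of_mem_of_not_mem hj h0I)
      intro j hj
      rcases Finset.mem_insert.1 hj with rfl | hj
      · have hs := Multiset.sum_count_eq_card (s := insert 0 I) (m := (g : Multiset ℕ)) hgI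
        simp only [Multiset.coe_count, Multiset.coe_card] at hs
        rw [Finset.sum_insert h0I, Finset.sum_congr rfl hgI', hsum] at hs
        omega
      · exact hgI' j hj
    · rintro ⟨g, hgT, hg⟩
      obtain ⟨hgp, hgS⟩ := Finset.mem_filter.1 hgT
      obtain ⟨hgm, hQ⟩ := Finset.mem_filter.1 hgS
      have hgN := hlen g hgp
      have hg0 : 0 < g.length := by omega
      have hgI := (mem_latticePaths.1 hgp).1
      refine ⟨⟨(hg.mem_lensEvent_iff h1 h2 hg0 hgI m).2 hgm, ?_⟩, g, hgN, hgI, hg⟩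
      rwa [hg.hopPathCount_eq h1 h2 hg0, ← hchain]
  rw [hset, measure_biUnion_finset]
  · have hq : ∀ g ∈ T, μ {ω | HasPattern (k + 2) r g (X ω)} =
        ∏ j ∈ I, (φ 1 ^ m j * φ 0 ^ (N - m j)) := by
      intro g hgT
      have hgp := (Finset.mem_filter.1 hgT).1
      rw [measure_hasPattern hX h1 h2, hlen g hgp]
      refine Finset.prod_congr rfl fun j hj => ?_
      have hj : j ∈ I := hj
      rw [(mem_latticePaths.1 hgp).2 j (Finset.mem_insert_of_mem hj), hm'I j hj]
    rw [Finset.sum_congr rfl hq, Finset.sum_const, nsmul_eq_mul,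
      card_latticePaths_insert_filter h0I m' hSsub]
    push_cast
    ring
  · intro g hg h hh hgh
    have hgp := (Finset.mem_filter.1 hg).1
    have hhp := (Finset.mem_filter.1 hh).1
    refine Set.disjoint_left.2 fun ω hgω hhω => hgh ?_
    exact HasPattern.unique ((hlen g hgp).trans (hlen h hhp).symm) (mem_latticePaths.1 hgp).1
      (mem_latticePaths.1 hhp).1 hgω hhω
  · exact fun g _ => measurableSet_hasPattern hX h1 h2 g

/-- Given the lens counts, the words are equally likely. -/
theorem multinomial_mul_measureReal {Ω : Type*} [MeasurableSpace Ω] {μ : Measure Ω}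
    [IsProbabilityMeasure μ] {lam : NNReal} {X : Ω → Finset ℝ} (hX : IsPoissonProcess μ lam X)
    {k : ℕ} {r : ℝ} (h1 : 1 < ((k + 2 : ℕ) : ℝ) * r)
    (h2 : (((k + 2 : ℕ) : ℝ) - 1) * r < 1) (m : ℕ → ℕ) (n : ℕ) :
    (Nat.multinomial (Finset.Icc 1 (k + 1)) m : ℝ) *
        μ.real (lensEvent X (k + 2) r m ∩ {ω | hopPathCount r (k + 2) (X ω) = n}) =
      ((latticePaths (Finset.Icc 1 (k + 1)) m).filter fun W => chainCount (k + 1) W = n).card *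
        μ.real (lensEvent X (k + 2) r m) := by
  have hl1 := (tendsto_measureReal_inter_sparseColumns hX h1 h2
    (lensEvent X (k + 2) r m ∩ {ω | hopPathCount r (k + 2) (X ω) = n})).const_mul
      (Nat.multinomial (Finset.Icc 1 (k + 1)) m : ℝ)
  have hl2 := (tendsto_measureReal_inter_sparseColumns hX h1 h2
    (lensEvent X (k + 2) r m)).const_mul
      (((latticePaths (Finset.Icc 1 (k + 1)) m).filter fun W =>
        chainCount (k + 1) W = n).card : ℝ)
  refine tendsto_nhds_unique_of_eventuallyEq hl1 hl2 ?_
  filter_upwards [eventually_gt_atTop (∑ j ∈ Finset.Icc 1 (k + 1), m j)] with N hN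
  obtain ⟨q, hq⟩ := exists_measure_inter_sparseColumns hX h1 h2 m hN
  have e1 := hq (· = n)
  have e2 := hq fun _ => True
  simp only [Set.ofPred_true, Set.inter_univ, Finset.filter_true] at e2
  rw [measureReal_def, measureReal_def, e1, e2, card_latticePaths, ENNReal.toReal_mul,
    ENNReal.toReal_mul, ENNReal.toReal_natCast, ENNReal.toReal_natCast]
  ring

theorem measure_lensEvent {Ω : Type*} [MeasurableSpace Ω] {μ : Measure Ω}
    {lam : NNReal} {X : Ω → Finset ℝ} (hX : IsPoissonProcess μ lam X)
    {k : ℕ} {r : ℝ} (h1 : 1 < k * r) (h2 : ((k : ℝ) - 1) * r < 1) (m : ℕ → ℕ) :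
    μ (lensEvent X k r m) =
      ∏ j ∈ Finset.Icc 1 (k - 1), poissonMeasure (lam * Real.toNNReal (k * r - 1)) {m j} := by
  rw [lensEvent, measure_forall_pointCount_eq hX _ _ (fun j _ => measurableSet_lens k r j)
    (fun j hj => (lens_subset_Ioo h1 h2 hj).trans Set.Ioo_subset_Icc_self)
    (fun i hi j hj hij => disjoint_lens h1 h2 hi hj hij)]
  refine Finset.prod_congr rfl fun j hj => ?_
  rw [volume_lens h1 h2 hj, ENNReal.ofReal, ENNReal.toNNReal_coe]

theorem measurableSet_lensEvent {Ω : Type*} [MeasurableSpace Ω] {μ : Measure Ω}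
    {lam : NNReal} {X : Ω → Finset ℝ} (hX : IsPoissonProcess μ lam X)
    {k : ℕ} {r : ℝ} (h1 : 1 < k * r) (h2 : ((k : ℝ) - 1) * r < 1) (m : ℕ → ℕ) :
    MeasurableSet (lensEvent X k r m) := by
  have : lensEvent X k r m = ⋂ j ∈ Finset.Icc 1 (k - 1),
      (fun ω => pointCount (X ω) (lens k r j)) ⁻¹' {m j} := by
    ext ω; simp [lensEvent]
  rw [this]
  exact Finset.measurableSet_biInter _ fun j hj => hX.measurable_count _ (measurableSet_lens k r j)
    ((lens_subset_Ioo h1 h2 hj).trans Set.Ioo_subset_Icc_self) (measurableSet_singleton _)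

theorem theorem1 {Ω : Type*} [MeasurableSpace Ω] (μ : MeasureTheory.Measure Ω)
    [MeasureTheory.IsProbabilityMeasure μ] (lam : NNReal) (X : Ω → Finset ℝ)
    (hX : IsPoissonProcess μ lam X) (k : ℕ) (hk : 3 ≤ k) (r₀ : ℝ)
    (hr₁ : 1 / (k : ℝ) < r₀) (hr₂ : r₀ < 1 / ((k : ℝ) - 1)) (m : ℕ → ℕ) :
    μ (lensEvent X k r₀ m) =
        ∏ j ∈ Finset.Icc 1 (k - 1),
          ProbabilityTheory.poissonMeasure (lam * Real.toNNReal (k * r₀ - 1)) {m j} ∧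
      (μ (lensEvent X k r₀ m) ≠ 0 → ∀ n : ℕ,
        (ProbabilityTheory.cond μ (lensEvent X k r₀ m)).real
            {ω | hopPathCount r₀ k (X ω) = n} =
          1 / (Nat.multinomial (Finset.Icc 1 (k - 1)) m : ℝ) *
            ∑ v ∈ latticePaths (Finset.Icc 1 (k - 2)) m,
              ∑ w ∈ latticePaths {k - 2, k - 1} m with pathDot m (k - 2) v w = n,
                (degeneracy m (k - 2) v w : ℝ)) := by
  have hk' : (3 : ℝ) ≤ k := by exact_mod_cast hk
  have h1 : 1 < k * r₀ := by rwa [div_lt_iff₀ (by linarith), mul_comm] at hr₁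
  have h2 : ((k : ℝ) - 1) * r₀ < 1 := by rwa [lt_div_iff₀ (by linarith), mul_comm] at hr₂
  refine ⟨measure_lensEvent hX h1 h2 m, fun hne n => ?_⟩
  have hmeas := measurableSet_lensEvent hX h1 h2 m
  obtain ⟨d, rfl⟩ : ∃ d, k = d + 1 + 2 := ⟨k - 3, by omega⟩
  have hmain := multinomial_mul_measureReal hX h1 h2 m n
  rw [card_filter_chainCount] at hmain
  simp only [show d + 1 + 2 - 1 = d + 1 + 1 by omega, show d + 1 + 2 - 2 = d + 1 by omega]
  have hne' : μ.real (lensEvent X (d + 1 + 2) r₀ m) ≠ 0 :=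
    (ENNReal.toReal_ne_zero).2 ⟨hne, measure_ne_top _ _⟩
  have hmul : (Nat.multinomial (Finset.Icc 1 (d + 1 + 1)) m : ℝ) ≠ 0 := by
    exact_mod_cast (Nat.multinomial_pos _ _).ne'
  rw [measureReal_def, cond_apply hmeas, ENNReal.toReal_mul, ENNReal.toReal_inv,
    ← measureReal_def, ← measureReal_def]
  push_cast at hmain
  field_simp
  rw [mul_comm, hmain, mul_comm]
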